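/- Let $K$ be a commutative ring and let $\Lambda$ be the ring of symmetric functions over $K$, i.e. the $K$-algebra of all symmetric formal power series of bounded degree in $x=(x_1,x_2,\dots)$ with coefficients in $K$. For a partition $\lambda$ let $g_\lambda=\sum_T x^T$ be the dual stable Grothendieck polynomial: the sum is over all reverse plane partitions $T$ of shape $\lambda$ (fillings of the boxes of $\lambda$ with positive integers that are weakly increasing along every row and column), and $x^T=\prod_i x_i^{T(i)}$, where $T(i)$ is the number of columns of $T$ that contain $i$. Let $\Delta\colon\Lambda\to\Lambda\otimes_K\Lambda$ be the coproduct $f(x)\mapsto f(x,y)$, that is, the unique $K$-linear map such that, for every $f\in\Lambda$, the image of $\Delta(f)$ under $\Lambda\otimes_K\Lambda\to K[[x,y]]$, $u\otimes v\mapsto u(x)v(y)$, is $f(x_1,x_2,\dots,y_1,y_2,\dots)$. Let $i\colon\Lambda\to K$ be the map $f\mapsto f(1,0,0,\dots)$. The $g_\lambda$ form a $K$-basis of $\Lambda$; let $I\colon\Lambda\to\Lambda$ be the $K$-linear map defined by $I(g_\lambda)=\sum_{\mu\subset\lambda}g_\mu$. Proposition. For every $f\in\Lambda$, $$I(f)(x_1,x_2,\dots)=f(1,x_1,x_2,\dots);$$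 equivalently, identifying $K\otimes_K\Lambda$ with $\Lambda$, $$I=(i\otimes\mathrm{id})\circ\Delta.$$ -/

import Mathlib

open scoped TensorProduct

namespace DualGrothendieck

noncomputable section

/-! ### The ring of symmetric functions

The variables are indexed by `ℕ`: the variable `X n` is $x_{n+1}$. -/

/-- The ring `Λ` of symmetric functions over `K`: formal power series in countably many variables,
invariant under all permutations of the variables, and of bounded degree. -/
def symmFunc (K : Type*) [CommRing K] : Subalgebra K (MvPowerSeries ℕ K) where
  carrier := {f | (∀ σ : Equiv.Perm ℕ, MvPowerSeries.rename σ f = f) ∧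
    ∃ N : ℕ, ∀ d : ℕ →₀ ℕ, N < d.degree → MvPowerSeries.coeff d f = 0}
  mul_mem' := by
    rintro f g ⟨hf, M, hM⟩ ⟨hg, N, hN⟩
    refine ⟨fun σ => by rw [map_mul, hf, hg], M + N, fun d hd => ?_⟩
    classical
    rw [MvPowerSeries.coeff_mul]
    refine Finset.sum_eq_zero fun p hp => ?_
    have h : p.1.degree + p.2.degree = d.degree := by
      rw [← Finset.HasAntidiagonal.mem_antidiagonal.mp hp, map_add]
    by_cases h1 : M < p.1.degree
    · rw [hM _ h1, zero_mul]
    · rw [hN p.2 (by omega), mul_zero]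
  add_mem' := by
    rintro f g ⟨hf, M, hM⟩ ⟨hg, N, hN⟩
    refine ⟨fun σ => by rw [map_add, hf, hg], M + N, fun d hd => ?_⟩
    rw [map_add, hM d (by omega), hN d (by omega), add_zero]
  algebraMap_mem' := by
    intro r
    refine ⟨fun σ => AlgHom.commutes _ r, 0, fun d hd => ?_⟩
    classical
    rw [MvPowerSeries.algebraMap_apply, MvPowerSeries.coeff_C, if_neg]
    rintro rfl
    simp at hd

/-! ### Substitutions -/

/-- The value `f(a 0, a 1, …) = ∑ d, (coeff d f) * ∏ n, a n ^ d n` at a sequence of scalars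
(for series for which this sum is finite). -/
def evalSeq {K : Type*} [CommRing K] (a : ℕ → K) (f : MvPowerSeries ℕ K) : K :=
  ∑ᶠ d : ℕ →₀ ℕ, MvPowerSeries.coeff d f * d.prod fun n k => a n ^ k

/-- The series `f(a 0, a 1, …) = ∑ d, (coeff d f) * ∏ n, a n ^ d n` obtained by substituting the
series `a n` for the variable `X n`, the sum being taken coefficientwise
(for series for which each of these sums is finite). -/
def substSeq {K : Type*} [CommRing K] (a : ℕ → MvPowerSeries ℕ K) (f : MvPowerSeries ℕ K) :
    MvPowerSeries ℕ K :=
  fun e => ∑ᶠ d : ℕ →₀ ℕ,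
    MvPowerSeries.coeff d f * MvPowerSeries.coeff e (d.prod fun n k => a n ^ k)

/-- The sequence `(1, 0, 0, …)`. -/
def oneZeros (K : Type*) [CommRing K] : ℕ → K
  | 0 => 1
  | _ + 1 => 0

/-- The sequence `(1, x₁, x₂, …)`. -/
def oneVars (K : Type*) [CommRing K] : ℕ → MvPowerSeries ℕ K
  | 0 => 1
  | n + 1 => MvPowerSeries.X n

theorem finite_setOf_zero_le_of_succ_eq (N : ℕ) (e : ℕ → ℕ) :
    {d : ℕ →₀ ℕ | d.degree ≤ N ∧ ∀ n, d (n + 1) = e n}.Finite := by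
  refine Set.Finite.of_finite_image (f := fun d : ℕ →₀ ℕ => d 0)
    ((Set.finite_Iic N).subset ?_) ?_
  · rintro _ ⟨d, hd, rfl⟩
    exact (Finsupp.le_degree 0 d).trans hd.1
  · intro d hd d' hd' h
    ext n
    cases n with
    | zero => exact h
    | succ n => rw [hd.2, hd'.2]

theorem finite_support_evalSeq {K : Type*} [CommRing K] {f : MvPowerSeries ℕ K}
    (hf : f ∈ symmFunc K) :
    (Function.support fun d : ℕ →₀ ℕ =>
      MvPowerSeries.coeff d f * d.prod fun n k => oneZeros K n ^ k).Finite := by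
  obtain ⟨-, N, hN⟩ := hf
  refine (finite_setOf_zero_le_of_succ_eq N 0).subset fun d hd => ⟨?_, fun n => ?_⟩
  · by_contra h
    exact hd (by simp [hN d (not_le.mp h)])
  · by_contra h
    refine hd ?_
    have : (d.prod fun n k => oneZeros K n ^ k) = 0 :=
      Finset.prod_eq_zero (Finsupp.mem_support_iff.mpr h) (zero_pow h)
    simp [this]

/-- The map `i : Λ → K`, `f ↦ f(1, 0, 0, …)`. -/
def evalOne (K : Type*) [CommRing K] : symmFunc K →ₗ[K] K where
  toFun f := evalSeq (oneZeros K) f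
  map_add' f g := by
    simp only [evalSeq]
    rw [← finsum_add_distrib (finite_support_evalSeq f.2) (finite_support_evalSeq g.2)]
    exact finsum_congr fun d => by simp [add_mul]
  map_smul' c f := by
    simp only [evalSeq, smul_eq_mul, RingHom.id_apply]
    rw [mul_finsum' _ _ (finite_support_evalSeq f.2)]
    exact finsum_congr fun d => by simp [mul_assoc]

/-- For a symmetric function `f`, the sums that define `f(1, x₁, x₂, …)` are finite. -/
theorem finite_support_substSeq {K : Type*} [CommRing K] {f : MvPowerSeries ℕ K}
    (hf : f ∈ symmFunc K) (e : ℕ →₀ ℕ) :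
    (Function.support fun d : ℕ →₀ ℕ => MvPowerSeries.coeff d f *
      MvPowerSeries.coeff e (d.prod fun n k => oneVars K n ^ k)).Finite := by
  classical
  obtain ⟨-, N, hN⟩ := hf
  refine (finite_setOf_zero_le_of_succ_eq N e).subset fun d hd => ?_
  have hinj : Set.InjOn Nat.succ (Nat.succ ⁻¹' (d.support : Set ℕ)) :=
    Nat.succ_injective.injOn
  have key : (d.prod fun n k => oneVars K n ^ k) =
      MvPowerSeries.monomial (d.comapDomain Nat.succ hinj) (1 : K) := by
    have h1 : (d.prod fun n k => oneVars K n ^ k) =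
        ∏ n ∈ Finset.range (d.support.sup id + 1 + 1), oneVars K n ^ d n := by
      refine Finset.prod_subset (fun n hn => ?_) fun n _ hn => ?_
      · have := Finset.le_sup (f := id) hn
        simp only [id] at this
        simp only [Finset.mem_range]
        omega
      · simp [Finsupp.notMem_support_iff.mp hn]
    rw [h1, Finset.prod_range_succ', MvPowerSeries.monomial_one_eq]
    simp only [oneVars, one_pow, mul_one]
    symm
    refine Finset.prod_subset (fun n hn => ?_) fun n _ hn => ?_
    · have hn' : n + 1 ∈ d.support := by simpa using hn
      have := Finset.le_sup (f := id) hn'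
      simp only [id] at this
      simp only [Finset.mem_range]
      omega
    · have : d (n + 1) = 0 := by simpa using hn
      simp [this]
  refine ⟨?_, fun n => ?_⟩
  · by_contra h
    exact hd (by simp [hN d (not_le.mp h)])
  · by_contra h
    refine hd ?_
    simp only
    rw [key, MvPowerSeries.coeff_monomial_ne, mul_zero]
    rintro rfl
    exact h rfl

/-! ### The coproduct -/

/-- The series `f(x, y) = f(x₁, x₂, …, y₁, y₂, …)` in two countable sets of variables: the
variables of `f` are renamed along a bijection `ℕ ≃ ℕ ⊕ ℕ` (for symmetric `f` its choice is
irrelevant). -/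
def doubleVars {K : Type*} [CommRing K] (f : MvPowerSeries ℕ K) : MvPowerSeries (ℕ ⊕ ℕ) K :=
  MvPowerSeries.rename Equiv.natSumNatEquivNat.symm f

/-- The map `Λ ⊗ Λ → K⟦x, y⟧`, `f ⊗ g ↦ f(x) g(y)`. -/
def tensorToSeries (K : Type*) [CommRing K] :
    symmFunc K ⊗[K] symmFunc K →ₐ[K] MvPowerSeries (ℕ ⊕ ℕ) K :=
  Algebra.TensorProduct.productMap
    ((MvPowerSeries.rename (Function.Embedding.inl : ℕ ↪ ℕ ⊕ ℕ)).comp (symmFunc K).val)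
    ((MvPowerSeries.rename (Function.Embedding.inr : ℕ ↪ ℕ ⊕ ℕ)).comp (symmFunc K).val)

/-- `Δ` is the coproduct of `Λ`: `Δ f` is the element of `Λ(x) ⊗ Λ(y)` that represents
`f(x, y)`. -/
def IsCoproduct {K : Type*} [CommRing K]
    (Δ : symmFunc K →ₗ[K] symmFunc K ⊗[K] symmFunc K) : Prop :=
  ∀ f : symmFunc K, tensorToSeries K (Δ f) = doubleVars (f : MvPowerSeries ℕ K)

/-! ### Dual stable Grothendieck polynomials -/

/-- A reverse plane partition of shape `lam / mu`: a filling of the cells (row, column) by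
elements of `ℕ`, weakly increasing in every row and column. The entry `n` stands for the positive
integer `n + 1`, in accordance with the numbering of the variables. -/
structure RPP (lam mu : YoungDiagram) where
  entry : {c : ℕ × ℕ // c ∈ lam.cells \ mu.cells} → ℕ
  row_weak : ∀ c c', c.1.1 = c'.1.1 → c.1.2 ≤ c'.1.2 → entry c ≤ entry c'
  col_weak : ∀ c c', c.1.2 = c'.1.2 → c.1.1 ≤ c'.1.1 → entry c ≤ entry c'

/-- The pairs `(j, n)` such that column `j` of `T` contains the entry `n`. -/
def RPP.columnEntries {lam mu : YoungDiagram} (T : RPP lam mu) : Finset (ℕ × ℕ) :=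
  Finset.univ.image fun c => (c.1.2, T.entry c)

/-- The exponent of the monomial `x^T`: the exponent of the variable `X n` is the number of columns
of `T` that contain `n`. -/
def RPP.weight {lam mu : YoungDiagram} (T : RPP lam mu) : ℕ →₀ ℕ :=
  ∑ p ∈ T.columnEntries, Finsupp.single p.2 1

theorem RPP.weight_apply {lam mu : YoungDiagram} (T : RPP lam mu) (n : ℕ) :
    T.weight n = (T.columnEntries.filter fun p => p.2 = n).card := by
  rw [RPP.weight, Finsupp.finsetSum_apply, Finset.card_filter]
  exact Finset.sum_congr rfl fun p _ => Finsupp.single_apply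

/-- There are finitely many reverse plane partitions of given shape and weight. -/
instance {lam mu : YoungDiagram} (d : ℕ →₀ ℕ) : Finite {T : RPP lam mu // T.weight = d} := by
  have hmem (T : {T : RPP lam mu // T.weight = d}) (c) : T.1.entry c ∈ d.support := by
    rw [Finsupp.mem_support_iff, ← DFunLike.congr_fun T.2 (T.1.entry c), RPP.weight_apply]
    refine Finset.card_ne_zero_of_mem (a := (c.1.2, T.1.entry c)) ?_
    simp only [Finset.mem_filter, and_true]
    exact Finset.mem_image_of_mem _ (Finset.mem_univ c)
  refine Finite.of_injective
    (β := {c : ℕ × ℕ // c ∈ lam.cells \ mu.cells} → d.support)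
    (fun T c => ⟨T.1.entry c, hmem T c⟩) ?_
  rintro ⟨⟨T, _, _⟩, _⟩ ⟨⟨T', _, _⟩, _⟩ h
  have : T = T' := funext fun c => congrArg Subtype.val (congrFun h c)
  subst this
  rfl

/-- The dual stable Grothendieck polynomial `g_{lam/mu} = ∑ x^T`, summed over the reverse plane
partitions `T` of shape `lam / mu`. -/
def gSkew (K : Type*) [CommRing K] (lam mu : YoungDiagram) : MvPowerSeries ℕ K :=
  fun d => (Nat.card {T : RPP lam mu // T.weight = d} : K)

/-- `g_lam = g_{lam/∅}`. -/
def g (K : Type*) [CommRing K] (lam : YoungDiagram) : MvPowerSeries ℕ K :=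
  gSkew K lam ⊥

/-! ### The map `I` -/

theorem finite_Iic (lam : YoungDiagram) : (Set.Iic lam).Finite := by
  refine Set.Finite.of_finite_image (f := YoungDiagram.cells)
    (lam.cells.powerset.finite_toSet.subset ?_) fun a _ b _ h => YoungDiagram.ext h
  rintro _ ⟨mu, hmu, rfl⟩
  simpa [YoungDiagram.cells_subset_iff] using hmu

/-- The finite set of the partitions `mu ⊂ lam`. -/
def subdiagrams (lam : YoungDiagram) : Finset YoungDiagram :=
  (finite_Iic lam).toFinset

/-- For a basis `b` of `Λ` indexed by partitions, the linear map `Λ → Λ` with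
`b lam ↦ ∑ mu ⊂ lam, b mu`. -/
def sumMap {K : Type*} [CommRing K] (b : Module.Basis YoungDiagram K (symmFunc K)) :
    symmFunc K →ₗ[K] symmFunc K :=
  b.constr K fun lam => ∑ mu ∈ subdiagrams lam, b mu

end

end DualGrothendieck

namespace DualGrothendieck

noncomputable section

/-! The heart of the matter is the symmetry of `g_lam`. In a reverse plane partition with largest
entry `N`, the cells with entry `N` form a skew shape `lam / mu`, and the exponent of the variable
`N` is the number of nonempty columns of that shape (`rppCount_single_add`). Each coefficient of
`g_lam` thus arises by applying operators `layerSum k`, one for each variable, and symmetry follows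
once these operators commute. For fixed `mu ≤ lam` this says that as many intermediate `nu` have
column counts `(k, l)` as `(l, k)` (`card_layers_comm`), i.e. that `∑ x ^ colCount nu mu * y ^
colCount lam nu` is a symmetric polynomial. It is computed column by column, with the invariant of
`transfer_structure`.

By symmetry, the variable set to `1` may be regarded as the largest one. Summing `layerSum k` over
all `k` removes the condition on columns and leaves the sum over all `mu ⊂ lam`, so `g_lam(1, x)` is
`I(g_lam)` (`sum_rppCount_consExp`).

A symmetric function is determined by its coefficients at partitions, and those of the `g_lam` are
unitriangular for the dominance order, extended to partitions of different sizes. Hence the `g_lam`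
form a basis, and coefficients at pairs of partitions are coordinates on `Λ ⊗ Λ`, which gives
existence and uniqueness of `Δ`. Both `f(1, x)` and `(i ⊗ id)(Δ f)` have at `e` the coefficient `∑
k, coeff (k, e) f`. -/

/-! ### Column-by-column transfer for pairs of layers -/

/-- The weight of a column of height `h` between the heights `a` and `b`: a factor `X 0` if the
lower part of the column is nonempty, a factor `X 1` if the upper part is. -/
def columnWeight (a b h : ℕ) : MvPolynomial (Fin 2) ℤ :=
  (if a < h then MvPolynomial.X 0 else 1) * (if h < b then MvPolynomial.X 1 else 1)

/-- The sum of the weights of the weakly decreasing sequences of `n` column heights between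
`a` and `b` that are at least `t`. -/
def transfer (a b : ℕ → ℕ) : ℕ → ℕ → MvPolynomial (Fin 2) ℤ
  | 0, _ => 1
  | n + 1, t => ∑ h ∈ Finset.Icc (max t (a n)) (b n), columnWeight (a n) (b n) h * transfer a b n h

theorem isSymmetric_X_add_X :
    (MvPolynomial.X 0 + MvPolynomial.X 1 : MvPolynomial (Fin 2) ℤ).IsSymmetric := by
  intro e
  have := (Equiv.sum_comp e (fun i : Fin 2 => (MvPolynomial.X i : MvPolynomial (Fin 2) ℤ)))
  simpa [Fin.sum_univ_two] using this

theorem isSymmetric_X_mul_X :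
    (MvPolynomial.X 0 * MvPolynomial.X 1 : MvPolynomial (Fin 2) ℤ).IsSymmetric := by
  intro e
  have := (Equiv.prod_comp e (fun i : Fin 2 => (MvPolynomial.X i : MvPolynomial (Fin 2) ℤ)))
  simpa [Fin.prod_univ_two] using this

theorem isSymmetric_sum {ι : Type*} (s : Finset ι) (f : ι → MvPolynomial (Fin 2) ℤ)
    (hf : ∀ i, (f i).IsSymmetric) : (∑ i ∈ s, f i).IsSymmetric :=
  (MvPolynomial.symmetricSubalgebra (Fin 2) ℤ).sum_mem fun i _ => hf i

/-- For general `t` the polynomial `transfer a b n t` is not symmetric. Its defect is `X 1` times a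
symmetric `p t`, and the difference relation between `U` and `p` makes the sum over the next column
telescope. The defect vanishes at `t = 0`. -/
theorem transfer_structure {a b : ℕ → ℕ} (ha : Antitone a) (hb : Antitone b)
    (hab : ∀ n, a n ≤ b n) (n : ℕ) :
    ∃ U p : ℕ → MvPolynomial (Fin 2) ℤ, (∀ t, (U t).IsSymmetric) ∧ (∀ t, (p t).IsSymmetric) ∧
      (∀ t < b n, U t - U (t + 1) = MvPolynomial.X 0 * MvPolynomial.X 1 * p t) ∧
      (∀ t ≤ b n, transfer a b n t = U t - MvPolynomial.X 1 * p t) ∧ ∀ t ≤ a n, p t = 0 := by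
  induction n with
  | zero =>
    exact ⟨fun _ => 1, fun _ => 0, fun _ => MvPolynomial.IsSymmetric.one,
      fun _ => MvPolynomial.IsSymmetric.zero, by simp, by simp [transfer], by simp⟩
  | succ n ih =>
    obtain ⟨U, p, hU, hp, hUp, hS, hp0⟩ := ih
    -- The column being added has index `n`, so the construction yields the bounds `b n` and `a n`;
    -- antitonicity weakens them to those at `n + 1`.
    suffices H : ∃ U' p' : ℕ → MvPolynomial (Fin 2) ℤ,
        (∀ t, (U' t).IsSymmetric) ∧ (∀ t, (p' t).IsSymmetric) ∧
        (∀ t < b n, U' t - U' (t + 1) = MvPolynomial.X 0 * MvPolynomial.X 1 * p' t) ∧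
        (∀ t ≤ b n, transfer a b (n + 1) t = U' t - MvPolynomial.X 1 * p' t) ∧
        ∀ t ≤ a n, p' t = 0 by
      obtain ⟨U', p', h1, h2, h3, h4, h5⟩ := H
      have hb' := hb n.le_succ
      have ha' := ha n.le_succ
      exact ⟨U', p', h1, h2, fun t ht => h3 t (ht.trans_le hb'), fun t ht => h4 t (ht.trans hb'),
        fun t ht => h5 t (ht.trans ha')⟩
    rcases (hab n).eq_or_lt with hE | hL
    · refine ⟨fun _ => U (a n), fun _ => 0, fun _ => hU _, fun _ => MvPolynomial.IsSymmetric.zero,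
        by simp, fun t ht => ?_, by simp⟩
      have hm : max t (b n) = b n := max_eq_right ht
      have hpa := hp0 _ hE.ge
      simp only [transfer, hE, hm, Finset.Icc_self, Finset.sum_singleton, hS _ le_rfl, hpa,
        columnWeight, lt_irrefl, if_false]
      ring
    · set x : MvPolynomial (Fin 2) ℤ := MvPolynomial.X 0 with hx
      set y : MvPolynomial (Fin 2) ℤ := MvPolynomial.X 1 with hy
      -- `B` is the term `h = b n`, of weight `x`, plus the end term `y * U (b n)` of the
      -- telescoping sum.
      set B := (x + y) * U (b n) - x * y * p (b n) with hB
      set U' : ℕ → MvPolynomial (Fin 2) ℤ :=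
        fun t => B + x * y * ∑ h ∈ Finset.Ico (max t (a n + 1)) (b n), U h with hU'
      have hstep : ∀ t, a n < t → t < b n → U' t = U' (t + 1) + x * y * U t := by
        intro t h1 h2
        simp only [hU', max_eq_left (show a n + 1 ≤ t by omega),
          max_eq_left (show a n + 1 ≤ t + 1 by omega)]
        rw [Finset.sum_eq_sum_Ico_succ_bot h2]
        ring
      have hlow : ∀ t ≤ a n, U' t = U' (a n + 1) := by
        intro t ht
        simp only [hU', max_eq_right (show t ≤ a n + 1 by omega), max_self]
      have hhigh : ∀ m t, t + m = b n → a n < t →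
          transfer a b (n + 1) t = U' t - y * U t := by
        intro m
        induction m with
        | zero =>
          intro t ht hat
          obtain rfl : t = b n := by omega
          simp only [transfer, hU', max_eq_left hat.le, max_eq_left (show a n + 1 ≤ b n by omega),
            Finset.Icc_self, Finset.Ico_self, Finset.sum_singleton, Finset.sum_empty, columnWeight,
            if_pos hL, lt_irrefl, if_false, hS _ le_rfl, hB]
          ring
        | succ m ihm =>
          intro t ht hat
          have h1 := ihm (t + 1) (by omega) (by omega)
          have h2 := hUp t (by omega)
          simp only [transfer, max_eq_left hat.le,
            max_eq_left (show a n ≤ t + 1 by omega)] at h1 ⊢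
          rw [← Finset.insert_Icc_add_one_left_eq_Icc (by omega : t ≤ b n),
            Finset.sum_insert (by simp), h1, hstep t hat (by omega), hS t (by omega), columnWeight,
            if_pos hat, if_pos (by omega)]
          -- An interior height has weight `x * y`, and `x * y * (U t - y * p t) = x * y * U t - y *
          -- (U t - U (t + 1))`.
          linear_combination y * h2
      refine ⟨U', fun t => if t ≤ a n then 0 else U t, fun t => ?_, fun t => ?_, fun t ht => ?_,
        fun t ht => ?_, fun t ht => if_pos ht⟩
      · exact (((isSymmetric_X_add_X.mul (hU _)).sub (isSymmetric_X_mul_X.mul (hp _))).add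
          (isSymmetric_X_mul_X.mul (isSymmetric_sum _ _ hU)))
      · dsimp only
        split_ifs
        · exact MvPolynomial.IsSymmetric.zero
        · exact hU t
      · by_cases h : t ≤ a n
        · simp only [h, if_true, mul_zero, sub_eq_zero]
          rcases h.eq_or_lt with h | h
          · rw [hlow t h.le, h]
          · rw [hlow t h.le, hlow (t + 1) h]
        · simp only [h, if_false]
          rw [hstep t (by omega) ht]
          ring
      · by_cases h : t ≤ a n
        · have h1 := hhigh (b n - (a n + 1)) (a n + 1) (by omega) (by omega)
          -- Since `p (a n) = 0`, this gives `U (a n) = U (a n + 1)`: the term `h = a n`, of weight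
          -- `y`, cancels the defect `y * U (a n + 1)`.
          have h2 := hUp (a n) hL
          simp only [h, if_true, mul_zero, sub_zero, hlow t h]
          simp only [transfer, max_eq_right h, max_eq_left (show a n ≤ a n + 1 by omega)] at h1 ⊢
          rw [← Finset.insert_Icc_add_one_left_eq_Icc hL.le,
            Finset.sum_insert (by simp), h1, hS _ hL.le, columnWeight, if_neg (lt_irrefl _),
            if_pos hL, hp0 _ le_rfl]
          rw [hp0 _ le_rfl] at h2
          linear_combination y * h2
        · simp only [h, if_false]
          exact hhigh (b n - t) t (by omega) (by omega)

theorem isSymmetric_transfer {a b : ℕ → ℕ} (ha : Antitone a) (hb : Antitone b)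
    (hab : ∀ n, a n ≤ b n) (n : ℕ) : (transfer a b n 0).IsSymmetric := by
  obtain ⟨U, p, hU, -, -, hS, hp⟩ := transfer_structure ha hb hab n
  rw [hS 0 (Nat.zero_le _), hp 0 (Nat.zero_le _), mul_zero, sub_zero]
  exact hU 0

/-- The weakly decreasing sequences of `n` column heights between `a` and `b` that are at
least `t`. -/
def heights (a b : ℕ → ℕ) (n t : ℕ) : Finset (Fin n → ℕ) := by
  classical
  exact (Fintype.piFinset fun j : Fin n => Finset.Icc (a j) (b j)).filter
    fun v => Antitone v ∧ ∀ j, t ≤ v j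

theorem mem_heights {a b : ℕ → ℕ} {n t : ℕ} {v : Fin n → ℕ} :
    v ∈ heights a b n t ↔ (∀ j : Fin n, a j ≤ v j ∧ v j ≤ b j) ∧ Antitone v ∧ ∀ j, t ≤ v j := by
  simp only [heights, Finset.mem_filter, Fintype.mem_piFinset, Finset.mem_Icc]

theorem antitone_iff_castSucc {n : ℕ} {v : Fin (n + 1) → ℕ} :
    Antitone v ↔ (Antitone fun j : Fin n => v j.castSucc) ∧
      ∀ j : Fin n, v (Fin.last n) ≤ v j.castSucc := by
  constructor
  · exact fun h => ⟨fun i j hij => h (by simpa using hij), fun j => h (Fin.le_last _)⟩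
  · rintro ⟨h1, h2⟩ i j hij
    induction j using Fin.lastCases with
    | last =>
      induction i using Fin.lastCases with
      | last => exact le_rfl
      | cast i => exact h2 i
    | cast j =>
      induction i using Fin.lastCases with
      | last => exact absurd hij (by simp [Fin.le_def])
      | cast i => exact h1 (by simpa using hij)

/-- The recursion splits off the last column, whose height is the lower bound for all the others. -/
theorem transfer_eq_sum (a b : ℕ → ℕ) (n t : ℕ) :
    transfer a b n t = ∑ v ∈ heights a b n t, ∏ j : Fin n, columnWeight (a j) (b j) (v j) := by
  induction n generalizing t with
  | zero =>
    have : heights a b 0 t = Finset.univ := by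
      ext v
      simp [mem_heights, Subsingleton.antitone, -Finset.univ_unique]
    simp [transfer, this]
  | succ n ih =>
    simp only [transfer, ih, Finset.mul_sum]
    rw [Finset.sum_sigma']
    refine Finset.sum_nbij' (fun s => Fin.snoc (α := fun _ => ℕ) s.2 s.1)
      (fun v => ⟨v (Fin.last n), fun j => v j.castSucc⟩) ?_ ?_ ?_ ?_ ?_
    · rintro ⟨h, v⟩ hv
      simp only [Finset.mem_sigma, Finset.mem_Icc, mem_heights] at hv ⊢
      obtain ⟨⟨h1, h2⟩, h3, h4, h5⟩ := hv
      rw [antitone_iff_castSucc]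
      simp only [Fin.forall_fin_succ', Fin.snoc_castSucc, Fin.snoc_last, Fin.val_castSucc,
        Fin.val_last]
      exact ⟨⟨h3, (le_max_right _ _).trans h1, h2⟩, ⟨h4, h5⟩,
        fun j => ((le_max_left _ _).trans h1).trans (h5 j), (le_max_left _ _).trans h1⟩
    · intro v hv
      simp only [Finset.mem_sigma, Finset.mem_Icc, mem_heights] at hv ⊢
      rw [antitone_iff_castSucc] at hv
      simp only [Fin.forall_fin_succ', Fin.val_castSucc, Fin.val_last] at hv
      obtain ⟨⟨h1, h2, h3⟩, ⟨h4, h5⟩, h6, h7⟩ := hv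
      exact ⟨⟨max_le h7 h2, h3⟩, h1, h4, h5⟩
    · rintro ⟨h, v⟩ _
      simp
    · intro v _
      exact Fin.snoc_init_self (α := fun _ => ℕ) v
    · rintro ⟨h, v⟩ _
      rw [Fin.prod_univ_castSucc, mul_comm]
      simp

/-! ### Layers of Young diagrams -/

theorem mem_subdiagrams {lam mu : YoungDiagram} : mu ∈ subdiagrams lam ↔ mu ≤ lam := by
  simp [subdiagrams]

/-- The number of nonempty columns of `lam / mu`. -/
def colCount (lam mu : YoungDiagram) : ℕ :=
  ((lam.cells \ mu.cells).image Prod.snd).card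

theorem colLen_le_colLen {mu lam : YoungDiagram} (h : mu ≤ lam) (j : ℕ) :
    mu.colLen j ≤ lam.colLen j := by
  by_contra! hlt
  have := h (YoungDiagram.mem_iff_lt_colLen.mpr hlt)
  exact lt_irrefl _ (YoungDiagram.mem_iff_lt_colLen.mp this)

theorem le_iff_colLen_le {mu lam : YoungDiagram} : mu ≤ lam ↔ ∀ j, mu.colLen j ≤ lam.colLen j :=
  ⟨colLen_le_colLen, fun h ⟨_, j⟩ hc => YoungDiagram.mem_iff_lt_colLen.mpr
    ((YoungDiagram.mem_iff_lt_colLen.mp hc).trans_le (h j))⟩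

theorem colLen_eq_zero {lam : YoungDiagram} {j : ℕ} (h : lam.rowLen 0 ≤ j) : lam.colLen j = 0 := by
  by_contra h0
  have := YoungDiagram.mem_iff_lt_colLen.mpr (Nat.pos_of_ne_zero h0)
  have := YoungDiagram.mem_iff_lt_rowLen.mp this
  omega

theorem ext_colLen {mu lam : YoungDiagram} (h : ∀ j, mu.colLen j = lam.colLen j) : mu = lam :=
  le_antisymm (le_iff_colLen_le.mpr fun j => (h j).le) (le_iff_colLen_le.mpr fun j => (h j).ge)

theorem colCount_eq_card_fin {lam mu : YoungDiagram} {n : ℕ} (hn : ∀ j, n ≤ j → lam.colLen j = 0) :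
    colCount lam mu =
      (Finset.univ.filter fun j : Fin n => mu.colLen j < lam.colLen j).card := by
  rw [colCount, ← Finset.card_map Fin.valEmbedding]
  congr 1
  ext j
  simp only [Finset.mem_image, Finset.mem_sdiff, YoungDiagram.mem_cells, Prod.exists,
    exists_eq_right, Finset.mem_map, Finset.mem_filter, Finset.mem_univ, true_and,
    Fin.valEmbedding_apply, YoungDiagram.mem_iff_lt_colLen, not_lt]
  constructor
  · rintro ⟨i, h1, h2⟩
    have hj : j < n := by
      by_contra! h
      rw [hn j h] at h1
      exact Nat.not_lt_zero _ h1
    exact ⟨⟨j, hj⟩, h2.trans_lt h1, rfl⟩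
  · rintro ⟨k, hk, rfl⟩
    exact ⟨_, hk, le_rfl⟩

/-- The Young diagram with given weakly decreasing column lengths. -/
def ofHeights {n : ℕ} (v : Fin n → ℕ) (hv : Antitone v) : YoungDiagram where
  cells := (Finset.univ : Finset (Fin n)).biUnion fun j => Finset.range (v j) ×ˢ {(j : ℕ)}
  isLowerSet := by
    rintro ⟨i, j⟩ ⟨i', j'⟩ ⟨hi, hj⟩ h
    simp only [Finset.coe_biUnion, Finset.coe_univ, Set.mem_univ, Set.iUnion_true, Set.mem_iUnion,
      Finset.mem_coe, Finset.mem_product, Finset.mem_range, Finset.mem_singleton] at h ⊢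
    obtain ⟨k, h1, rfl⟩ := h
    simp only at hi hj
    have hk : j' < n := hj.trans_lt k.2
    exact ⟨⟨j', hk⟩, (hi.trans_lt h1).trans_le (hv (show (⟨j', hk⟩ : Fin n) ≤ k from hj)), rfl⟩

theorem colLen_ofHeights {n : ℕ} (v : Fin n → ℕ) (hv : Antitone v) (j : ℕ) :
    (ofHeights v hv).colLen j = if h : j < n then v ⟨j, h⟩ else 0 := by
  refine eq_of_forall_lt_iff fun i => ?_
  rw [← YoungDiagram.mem_iff_lt_colLen, ← YoungDiagram.mem_cells]
  simp only [ofHeights, Finset.mem_biUnion, Finset.mem_univ, true_and, Finset.mem_product,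
    Finset.mem_range, Finset.mem_singleton]
  split_ifs with h
  · exact ⟨by rintro ⟨k, h1, rfl⟩; exact h1, fun h1 => ⟨⟨j, h⟩, h1, rfl⟩⟩
  · simp only [not_lt_zero, iff_false, not_exists, not_and]
    rintro k _ rfl
    exact h k.2

-- A diagram amounts to its column lengths, and a column of `nu / mu` is nonempty exactly when its
-- lengths in `mu` and `nu` differ. So the monomial of `nu` is the product of its column weights.
open Classical in
theorem sum_layers_eq_transfer {mu lam : YoungDiagram} (h : mu ≤ lam) :
    ∑ nu ∈ (subdiagrams lam).filter (mu ≤ ·),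
      (MvPolynomial.X 0 ^ colCount nu mu * MvPolynomial.X 1 ^ colCount lam nu :
        MvPolynomial (Fin 2) ℤ) = transfer mu.colLen lam.colLen (lam.rowLen 0) 0 := by
  have hlam : ∀ j, lam.rowLen 0 ≤ j → lam.colLen j = 0 := fun j => colLen_eq_zero
  rw [transfer_eq_sum]
  refine Finset.sum_bij' (fun nu _ j => nu.colLen j)
    (fun v hv => ofHeights v (mem_heights.mp hv).2.1) ?_ ?_ ?_ ?_ ?_
  · intro nu hnu
    simp only [Finset.mem_filter, mem_subdiagrams] at hnu
    exact mem_heights.mpr ⟨fun j => ⟨colLen_le_colLen hnu.2 j, colLen_le_colLen hnu.1 j⟩,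
      fun i j hij => nu.colLen_anti _ _ hij, fun _ => Nat.zero_le _⟩
  · intro v hv
    rw [mem_heights] at hv
    simp only [Finset.mem_filter, mem_subdiagrams, le_iff_colLen_le, colLen_ofHeights,
      ← forall_and]
    intro j
    split_ifs with hj
    · exact (hv.1 ⟨j, hj⟩).symm
    · have := hlam j (not_lt.mp hj)
      have := colLen_le_colLen h j
      omega
  · intro nu hnu
    simp only [Finset.mem_filter, mem_subdiagrams] at hnu
    refine ext_colLen fun j => ?_
    rw [colLen_ofHeights]
    split_ifs with hj
    · rfl
    · have := hlam j (not_lt.mp hj)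
      have := colLen_le_colLen hnu.1 j
      omega
  · intro v hv
    ext j
    simp [colLen_ofHeights]
  · intro nu hnu
    simp only [Finset.mem_filter, mem_subdiagrams] at hnu
    have hnu0 : ∀ j, lam.rowLen 0 ≤ j → nu.colLen j = 0 := fun j hj => by
      have := colLen_le_colLen hnu.1 j
      have := hlam j hj
      omega
    simp only [columnWeight, Finset.prod_mul_distrib]
    rw [colCount_eq_card_fin hlam, colCount_eq_card_fin hnu0, Finset.prod_ite, Finset.prod_ite]
    simp

-- These are the coefficients of two monomials exchanged by swapping the variables of a symmetric
-- polynomial.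
open Classical in
theorem card_layers_comm {mu lam : YoungDiagram} (h : mu ≤ lam) (k l : ℕ) :
    ((subdiagrams lam).filter fun nu => mu ≤ nu ∧ colCount nu mu = k ∧ colCount lam nu = l).card =
    ((subdiagrams lam).filter
      fun nu => mu ≤ nu ∧ colCount nu mu = l ∧ colCount lam nu = k).card := by
  have hs := isSymmetric_transfer (fun i j hij => mu.colLen_anti i j hij)
    (fun i j hij => lam.colLen_anti i j hij) (colLen_le_colLen h) (lam.rowLen 0)
  rw [← sum_layers_eq_transfer h] at hs
  have key (c : ℕ × ℕ) : MvPolynomial.coeff (Finsupp.single 0 c.1 + Finsupp.single 1 c.2)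
      (∑ nu ∈ (subdiagrams lam).filter (mu ≤ ·),
      (MvPolynomial.X 0 ^ colCount nu mu * MvPolynomial.X 1 ^ colCount lam nu :
        MvPolynomial (Fin 2) ℤ)) = (((subdiagrams lam).filter
      fun nu => mu ≤ nu ∧ colCount nu mu = c.1 ∧ colCount lam nu = c.2).card : ℤ) := by
    rw [MvPolynomial.coeff_sum, ← Finset.filter_filter, Finset.card_filter, Nat.cast_sum]
    refine Finset.sum_congr rfl fun nu _ => ?_
    rw [MvPolynomial.X_pow_eq_monomial, MvPolynomial.X_pow_eq_monomial,
      MvPolynomial.monomial_mul, MvPolynomial.coeff_monomial]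
    have : (Finsupp.single (0 : Fin 2) (colCount nu mu) + Finsupp.single 1 (colCount lam nu) =
        Finsupp.single 0 c.1 + Finsupp.single 1 c.2) ↔
        (colCount nu mu = c.1 ∧ colCount lam nu = c.2) := by
      simp [Finsupp.ext_iff, Fin.forall_fin_two]
    simp [this]
  have h1 := key (k, l)
  have h2 := key (l, k)
  have h3 := hs (Equiv.swap 0 1)
  rw [← h3, show (Finsupp.single 0 (k, l).1 + Finsupp.single 1 (k, l).2 : Fin 2 →₀ ℕ) =
    
      (Finsupp.single 0 (l, k).1 + Finsupp.single 1 (l, k).2 : Fin 2 →₀ ℕ).mapDomain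
        (Equiv.swap 0 1) by
      simp [Finsupp.mapDomain_add, Finsupp.mapDomain_single, add_comm],
    MvPolynomial.coeff_rename_mapDomain _ (Equiv.injective _), h2] at h1
  exact_mod_cast h1.symm

open Classical in
/-- `layerSum k φ lam` is the sum of `φ mu` over the `mu ⊂ lam` such that `lam / mu` has `k`
nonempty columns. -/
def layerSum (k : ℕ) (φ : YoungDiagram → ℕ) (lam : YoungDiagram) : ℕ :=
  ∑ mu ∈ (subdiagrams lam).filter (colCount lam · = k), φ mu

open Classical in
theorem layerSum_layerSum (k l : ℕ) (φ : YoungDiagram → ℕ) (lam : YoungDiagram) :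
    layerSum k (layerSum l φ) lam = ∑ mu ∈ subdiagrams lam, ((subdiagrams lam).filter
      fun nu => mu ≤ nu ∧ colCount nu mu = l ∧ colCount lam nu = k).card * φ mu := by
  simp only [layerSum, Finset.card_filter, Finset.sum_mul, Finset.sum_filter]
  rw [Finset.sum_comm]
  refine Finset.sum_congr rfl fun nu hnu => ?_
  rw [mem_subdiagrams] at hnu
  split_ifs with hk
  · rw [← Finset.sum_filter]
    simp only [ite_mul, one_mul, zero_mul, ← Finset.sum_filter, hk, and_true]
    refine Finset.sum_congr ?_ fun _ _ => rfl
    ext mu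
    simp only [Finset.mem_filter, mem_subdiagrams]
    exact ⟨fun h => ⟨h.1.trans hnu, h⟩, fun h => h.2⟩
  · simp [hk]

/-- This makes `Multiset.foldr layerSum` meaningful: the order of the layers is irrelevant. -/
instance : LeftCommutative layerSum where
  left_comm k l φ := by
    classical
    ext lam
    rw [layerSum_layerSum, layerSum_layerSum]
    refine Finset.sum_congr rfl fun mu hmu => ?_
    rw [card_layers_comm (mem_subdiagrams.mp hmu)]

/-! ### Removing the largest entries of a reverse plane partition -/

/-- A cell of `lam`, as a cell of `lam / ∅`. -/
def cell {lam : YoungDiagram} {c : ℕ × ℕ} (h : c ∈ lam) :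
    {c : ℕ × ℕ // c ∈ lam.cells \ (⊥ : YoungDiagram).cells} :=
  ⟨c, by simpa using h⟩

theorem mem_of_cell {lam : YoungDiagram}
    (c : {c : ℕ × ℕ // c ∈ lam.cells \ (⊥ : YoungDiagram).cells}) : c.1 ∈ lam := by
  simpa using c.2

namespace RPP

variable {lam mu : YoungDiagram}

theorem ext_entry {T T' : RPP lam mu} (h : ∀ c, T.entry c = T'.entry c) : T = T' := by
  obtain ⟨e, _, _⟩ := T
  obtain ⟨e', _, _⟩ := T'
  obtain rfl : e = e' := funext h
  rfl

theorem entry_mono (T : RPP lam ⊥)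
    {c c' : {c : ℕ × ℕ // c ∈ lam.cells \ (⊥ : YoungDiagram).cells}} (h : c.1 ≤ c'.1) :
    T.entry c ≤ T.entry c' := by
  have hm : (c.1.1, c'.1.2) ∈ lam := lam.up_left_mem h.1 le_rfl (mem_of_cell c')
  exact (T.row_weak c (cell hm) rfl h.2).trans (T.col_weak (cell hm) c' rfl h.1)

theorem mem_columnEntries (T : RPP lam ⊥) {p : ℕ × ℕ} :
    p ∈ T.columnEntries ↔ ∃ i, ∃ h : (i, p.1) ∈ lam, T.entry (cell h) = p.2 := by
  simp only [columnEntries, Finset.mem_image, Finset.mem_univ, true_and]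
  constructor
  · rintro ⟨c, rfl⟩
    exact ⟨c.1.1, mem_of_cell c, rfl⟩
  · rintro ⟨i, h, hp⟩
    exact ⟨cell h, Prod.ext rfl hp⟩

theorem weight_entry_ne_zero (T : RPP lam ⊥)
    (c : {c : ℕ × ℕ // c ∈ lam.cells \ (⊥ : YoungDiagram).cells}) : T.weight (T.entry c) ≠ 0 := by
  rw [weight_apply]
  refine Finset.card_ne_zero_of_mem (a := (c.1.2, T.entry c)) ?_
  simp only [Finset.mem_filter, and_true]
  exact Finset.mem_image_of_mem _ (Finset.mem_univ c)

/-- The restriction of a reverse plane partition to a smaller diagram. -/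
def restrict (h : mu ≤ lam) (T : RPP lam ⊥) : RPP mu ⊥ where
  entry c := T.entry (cell (h (mem_of_cell c)))
  row_weak _ _ h1 h2 := T.row_weak _ _ h1 h2
  col_weak _ _ h1 h2 := T.col_weak _ _ h1 h2

/-- The extension of a reverse plane partition to a larger diagram by entries `N`. -/
def extend (lam : YoungDiagram) (N : ℕ) (T : RPP mu ⊥) (hT : ∀ c, T.entry c < N) : RPP lam ⊥ where
  entry c := if h : c.1 ∈ mu then T.entry (cell h) else N
  row_weak c c' h1 h2 := by
    by_cases hc' : c'.1 ∈ mu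
    · have hc : c.1 ∈ mu := mu.up_left_mem h1.le h2 hc'
      simpa only [hc, hc', dif_pos] using T.row_weak _ _ h1 h2
    · rw [dif_neg hc']
      split_ifs
      exacts [(hT _).le, le_rfl]
  col_weak c c' h1 h2 := by
    by_cases hc' : c'.1 ∈ mu
    · have hc : c.1 ∈ mu := mu.up_left_mem h2 h1.le hc'
      simpa only [hc, hc', dif_pos] using T.col_weak _ _ h1 h2
    · rw [dif_neg hc']
      split_ifs
      exacts [(hT _).le, le_rfl]

/-- The diagram of the cells with entries less than `N`. -/
def below (T : RPP lam ⊥) (N : ℕ) : YoungDiagram where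
  cells := by
    classical
    exact lam.cells.filter fun c => ∃ h : c ∈ lam, T.entry (cell h) < N
  isLowerSet := by
    intro c c' hcc h
    simp only [Finset.coe_filter, YoungDiagram.mem_cells, Set.mem_ofPred_eq] at h ⊢
    obtain ⟨-, h, hN⟩ := h
    have h' : c' ∈ lam := lam.isLowerSet hcc h
    exact ⟨h', h', (T.entry_mono hcc).trans_lt hN⟩

theorem mem_below (T : RPP lam ⊥) {N : ℕ} {c : ℕ × ℕ} :
    c ∈ T.below N ↔ ∃ h : c ∈ lam, T.entry (cell h) < N := by
  rw [← YoungDiagram.mem_cells]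
  simp only [below, Finset.mem_filter, YoungDiagram.mem_cells]
  exact ⟨fun h => h.2, fun h => ⟨h.1, h⟩⟩

/-- New cells carry only `N` and old cells only smaller entries, so no pair (column, entry) is
counted twice. -/
theorem weight_extend (hle : mu ≤ lam) (N : ℕ) (T : RPP mu ⊥) (hT : ∀ c, T.entry c < N) :
    (extend lam N T hT).weight = Finsupp.single N (colCount lam mu) + T.weight := by
  classical
  have hcol : (extend lam N T hT).columnEntries =
      (((lam.cells \ mu.cells).image Prod.snd) ×ˢ {N}) ∪ T.columnEntries := by
    ext ⟨j, n⟩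
    simp only [mem_columnEntries, Finset.mem_union, Finset.mem_product, Finset.mem_image,
      Finset.mem_sdiff, YoungDiagram.mem_cells, Prod.exists, exists_eq_right,
      Finset.mem_singleton]
    constructor
    · rintro ⟨i, h, hn⟩
      by_cases hm : (i, j) ∈ mu
      · exact Or.inr ⟨i, hm, by simpa [extend, cell, hm] using hn⟩
      · exact Or.inl ⟨⟨i, h, hm⟩, by simpa [extend, cell, hm] using hn.symm⟩
    · rintro (⟨⟨i, h, hm⟩, rfl⟩ | ⟨i, hm, hn⟩)
      · exact ⟨i, h, by simp [extend, cell, hm]⟩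
      · exact ⟨i, hle hm, by simpa [extend, cell, hm] using hn⟩
  have hdisj : Disjoint (((lam.cells \ mu.cells).image Prod.snd) ×ˢ {N}) T.columnEntries := by
    rw [Finset.disjoint_left]
    rintro ⟨j, n⟩ h1 h2
    obtain ⟨i, h, hn⟩ := T.mem_columnEntries.mp h2
    simp only [Finset.mem_product, Finset.mem_singleton] at h1
    exact absurd (hT (cell h)) (by simp only at hn; omega)
  rw [weight, hcol, Finset.sum_union hdisj, Finset.sum_product]
  simp [weight, colCount]

end RPP

/-! ### Counting by weight, and the symmetry of the `g_lam` -/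

/-- The number of reverse plane partitions of shape `lam` and weight `d`. -/
def rppCount (lam : YoungDiagram) (d : ℕ →₀ ℕ) : ℕ :=
  Nat.card {T : RPP lam ⊥ // T.weight = d}

theorem coeff_g (K : Type*) [CommRing K] (lam : YoungDiagram) (d : ℕ →₀ ℕ) :
    MvPowerSeries.coeff d (g K lam) = rppCount lam d := rfl

theorem RPP.entry_lt {lam : YoungDiagram} {d : ℕ →₀ ℕ} {N : ℕ} (hd : ∀ c ∈ d.support, c < N)
    {T : RPP lam ⊥} (hT : T.weight = d) (c) : T.entry c < N :=
  hd _ (by rw [← hT, Finsupp.mem_support_iff]; exact T.weight_entry_ne_zero c)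

-- A filling is determined by the diagram `mu` of its entries below `N` and its restriction to `mu`,
-- all other entries being `N`. The case `k = 0` is included; then `mu = lam`.
open Classical in
theorem rppCount_single_add (lam : YoungDiagram) {d : ℕ →₀ ℕ} {N : ℕ} (k : ℕ)
    (hd : ∀ c ∈ d.support, c < N) :
    rppCount lam (Finsupp.single N k + d) = layerSum k (fun mu => rppCount mu d) lam := by
  let s := (subdiagrams lam).filter (colCount lam · = k)
  have hs {mu} : mu ∈ s ↔ mu ≤ lam ∧ colCount lam mu = k := by simp [s, mem_subdiagrams]
  let F : (Σ mu : s, {T : RPP mu.1 ⊥ // T.weight = d}) →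
      {T : RPP lam ⊥ // T.weight = Finsupp.single N k + d} := fun x =>
    ⟨RPP.extend lam N x.2.1 (RPP.entry_lt hd x.2.2), by
      rw [RPP.weight_extend (hs.mp x.1.2).1, (hs.mp x.1.2).2, x.2.2]⟩
  have hF : Function.Bijective F := by
    constructor
    · rintro ⟨⟨mu, hmu⟩, T, hT⟩ ⟨⟨mu', hmu'⟩, T', hT'⟩ h
      have he := congrArg (fun T => T.1.entry) h
      -- The diagram is recovered from the extension; only after the diagrams are identified can the
      -- fillings be compared.
      have hb : ∀ {mu} (hmu : mu ∈ s) {T : RPP mu ⊥} (hT : T.weight = d),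
          mu = (RPP.extend lam N T (RPP.entry_lt hd hT)).below N := by
        intro mu hmu T hT
        ext c
        simp only [YoungDiagram.mem_cells, RPP.mem_below]
        constructor
        · intro hc
          exact ⟨(hs.mp hmu).1 hc, by simpa [RPP.extend, cell, hc] using RPP.entry_lt hd hT _⟩
        · rintro ⟨h, h1⟩
          by_contra hc
          simp [RPP.extend, cell, hc] at h1
      obtain rfl : mu = mu' := by
        rw [hb hmu hT, hb hmu' hT']
        exact congrArg (fun T => T.1.below N) h
      obtain rfl : T = T' := by
        refine RPP.ext_entry fun c => ?_
        have hc := mem_of_cell c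
        have := congrFun he (cell ((hs.mp hmu).1 hc))
        simpa [F, RPP.extend, cell, hc] using this
      rfl
    · rintro ⟨T, hT⟩
      have hle : T.below N ≤ lam := fun c hc => (T.mem_below.mp hc).1
      have hlt : ∀ c, (T.restrict hle).entry c < N := fun c => (T.mem_below.mp (mem_of_cell c)).2
      have hTN : ∀ c, T.entry c ≤ N := by
        intro c
        have h0 := T.weight_entry_ne_zero c
        by_contra! hN
        rw [hT, Finsupp.add_apply, Finsupp.single_eq_of_ne (by omega), zero_add] at h0
        exact absurd (hd _ (Finsupp.mem_support_iff.mpr h0)) (by omega)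
      have hext : RPP.extend lam N (T.restrict hle) hlt = T := by
        refine RPP.ext_entry fun c => ?_
        by_cases hc : c.1 ∈ T.below N
        · simp [RPP.extend, hc, RPP.restrict, cell]
        · have h1 : ¬ T.entry c < N := fun h => hc (T.mem_below.mpr ⟨mem_of_cell c, h⟩)
          have h2 := hTN c
          simp only [RPP.extend, hc, dif_neg, not_false_eq_true]
          omega
      have hw := RPP.weight_extend hle N (T.restrict hle) hlt
      rw [hext, hT] at hw
      -- Evaluating `hw` at `N`, where `d` and the weight of the restriction vanish, identifies the
      -- column count with `k`.
      have hNd : d N = 0 := by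
        by_contra h
        exact lt_irrefl _ (hd N (Finsupp.mem_support_iff.mpr h))
      have hNr : (T.restrict hle).weight N = 0 := by
        by_contra h
        rw [RPP.weight_apply, ← ne_eq, Finset.card_ne_zero] at h
        obtain ⟨p, hp⟩ := h
        rw [Finset.mem_filter, RPP.mem_columnEntries] at hp
        obtain ⟨⟨i, h, h1⟩, h2⟩ := hp
        exact absurd (hlt (cell h)) (by omega)
      have hk : colCount lam (T.below N) = k := by
        have := DFunLike.congr_fun hw N
        simpa [hNd, hNr] using this.symm
      refine ⟨⟨⟨T.below N, hs.mpr ⟨hle, hk⟩⟩, T.restrict hle, ?_⟩, Subtype.ext hext⟩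
      rw [hk] at hw
      exact (add_left_cancel hw).symm
  rw [rppCount, ← Nat.card_eq_of_bijective F hF, Nat.card_sigma, layerSum]
  exact Finset.sum_coe_sort s fun mu => rppCount mu d

/-- The right-hand side sees only the multiset of nonzero exponents of `d`, not their positions;
this is the symmetry. The largest index in the support is the outermost layer. -/
theorem rppCount_eq_foldr (d : ℕ →₀ ℕ) :
    (fun lam => rppCount lam d) =
      Multiset.foldr layerSum (fun lam => rppCount lam 0) (d.support.val.map d) := by
  induction d using Finsupp.induction_on_max with
  | zero => simp
  | single_add N k d hN hk ih =>
    have hNd : N ∉ d.support := fun h => lt_irrefl _ (hN N h)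
    have hsupp : (Finsupp.single N k + d).support = Finset.cons N d.support hNd := by
      ext n
      by_cases h : n = N
      · subst h
        simp [hk]
      · simp [h, Finsupp.single_eq_of_ne h]
    rw [hsupp, Finset.cons_val, Multiset.map_cons, Multiset.foldr_cons]
    have h1 : Multiset.map (Finsupp.single N k + d) d.support.val = Multiset.map d d.support.val := by
      refine Multiset.map_congr rfl fun n hn => ?_
      have : n ≠ N := (hN n hn).ne
      simp [Finsupp.single_eq_of_ne this]
    have h2 : (Finsupp.single N k + d) N = k := by
      simpa using hNd
    rw [h1, ← ih, h2]
    ext lam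
    exact rppCount_single_add lam k hN

/-- Relabelling preserves the multiset of nonzero exponents. Surjectivity plays no role, and maps
that are not surjective occur below. -/
theorem rppCount_mapDomain (lam : YoungDiagram) (d : ℕ →₀ ℕ) {f : ℕ → ℕ}
    (hf : Function.Injective f) : rppCount lam (d.mapDomain f) = rppCount lam d := by
  have h : (d.mapDomain f).support.val.map (d.mapDomain f) = d.support.val.map d := by
    classical
    rw [Finsupp.mapDomain_support_of_injective hf, Finset.image_val_of_injOn hf.injOn,
      Multiset.map_map]
    exact Multiset.map_congr rfl fun n _ => Finsupp.mapDomain_apply hf d n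
  have h1 := congrFun (rppCount_eq_foldr (d.mapDomain f)) lam
  rw [h, ← rppCount_eq_foldr] at h1
  exact h1

theorem RPP.degree_weight {lam mu : YoungDiagram} (T : RPP lam mu) :
    T.weight.degree = T.columnEntries.card := by
  rw [RPP.weight, map_sum]
  simp

theorem rppCount_eq_zero_of_card_lt {lam : YoungDiagram} {d : ℕ →₀ ℕ} (h : lam.card < d.degree) :
    rppCount lam d = 0 := by
  have : IsEmpty {T : RPP lam ⊥ // T.weight = d} := by
    constructor
    rintro ⟨T, rfl⟩
    rw [T.degree_weight] at h
    refine h.not_ge (Finset.card_image_le.trans ?_)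
    simp
  rw [rppCount, Nat.card_of_isEmpty]

theorem coeff_mapDomain_rename {K σ τ : Type*} [CommRing K] (e : σ ≃ τ)
    (f : MvPowerSeries σ K) (d : σ →₀ ℕ) :
    MvPowerSeries.coeff (d.mapDomain e) (MvPowerSeries.rename e f) = MvPowerSeries.coeff d f := by
  have := MvPowerSeries.coeff_embDomain_rename e.toEmbedding f d
  rwa [Finsupp.embDomain_eq_mapDomain] at this

theorem rename_eq_self_iff {K σ : Type*} [CommRing K] (e : Equiv.Perm σ)
    (f : MvPowerSeries σ K) : MvPowerSeries.rename e f = f ↔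
      ∀ d, MvPowerSeries.coeff (d.mapDomain e) f = MvPowerSeries.coeff d f := by
  constructor
  · intro h d
    conv_lhs => rw [← h]
    exact coeff_mapDomain_rename e f d
  · intro h
    ext d
    obtain ⟨d, rfl⟩ : ∃ d', Finsupp.mapDomain e d' = d :=
      ⟨d.mapDomain e.symm, by rw [← Finsupp.mapDomain_comp]; simp⟩
    rw [coeff_mapDomain_rename, h]

theorem g_mem_symmFunc (K : Type*) [CommRing K] (lam : YoungDiagram) : g K lam ∈ symmFunc K := by
  refine ⟨fun σ => (rename_eq_self_iff σ _).mpr fun d => ?_, lam.card, fun d hd => ?_⟩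
  · rw [coeff_g, coeff_g, rppCount_mapDomain _ _ σ.injective]
  · rw [coeff_g, rppCount_eq_zero_of_card_lt hd, Nat.cast_zero]

/-! ### Coefficients of symmetric functions at partitions -/

theorem rowLen_eq_zero {lam : YoungDiagram} {i : ℕ} (h : lam.colLen 0 ≤ i) : lam.rowLen i = 0 := by
  rw [← YoungDiagram.colLen_transpose]
  exact colLen_eq_zero (by rwa [YoungDiagram.rowLen_transpose])

/-- The partition `lam`, as an exponent. -/
def rowExp (lam : YoungDiagram) : ℕ →₀ ℕ :=
  Finsupp.onFinset (Finset.range (lam.colLen 0)) lam.rowLen fun i hi => by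
    rw [Finset.mem_range]
    by_contra! h
    exact hi (rowLen_eq_zero h)

theorem rowExp_apply (lam : YoungDiagram) (i : ℕ) : rowExp lam i = lam.rowLen i := rfl

theorem exists_mapDomain_rowExp (d : ℕ →₀ ℕ) :
    ∃ (σ : Equiv.Perm ℕ) (mu : YoungDiagram), (rowExp mu).mapDomain σ = d := by
  obtain ⟨n, hn⟩ : ∃ n, ∀ i, n ≤ i → d i = 0 := by
    refine ⟨d.support.sup id + 1, fun i hi => ?_⟩
    by_contra h
    have := Finset.le_sup (f := id) (Finsupp.mem_support_iff.mpr h)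
    simp only [id] at this
    omega
  let v : Fin n → ℕ := fun j => d j
  let τ : Equiv.Perm (Fin n) := Tuple.sort (OrderDual.toDual ∘ v)
  -- Sorting in the dual order makes the exponents decrease. `ofHeights` turns them into columns,
  -- hence the transpose below.
  have hv : Antitone (v ∘ τ) := fun i j hij => Tuple.monotone_sort (OrderDual.toDual ∘ v) hij
  let σ : Equiv.Perm ℕ := τ.extendDomain Fin.equivSubtype
  refine ⟨σ, (ofHeights _ hv).transpose, ?_⟩
  ext j
  obtain ⟨i, rfl⟩ := σ.surjective j
  rw [Finsupp.mapDomain_apply σ.injective, rowExp_apply, YoungDiagram.rowLen_transpose,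
    colLen_ofHeights]
  split_ifs with h
  · exact congrArg d (Equiv.Perm.extendDomain_apply_subtype τ Fin.equivSubtype h).symm
  · rw [show σ i = i from Equiv.Perm.extendDomain_apply_not_subtype τ _ h, hn i (not_lt.mp h)]

/-- The number of cells of `lam` in the first `k` rows. -/
def rowSum (lam : YoungDiagram) (k : ℕ) : ℕ :=
  (lam.cells.filter fun c => c.1 < k).card

theorem rowSum_eq_sum_rowLen (lam : YoungDiagram) (k : ℕ) :
    rowSum lam k = ∑ i ∈ Finset.range k, lam.rowLen i := by
  rw [rowSum, Finset.card_eq_sum_card_fiberwise (f := Prod.fst) (t := Finset.range k)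
    (fun c hc => by simpa using (Finset.mem_filter.mp hc).2)]
  refine Finset.sum_congr rfl fun i hi => ?_
  rw [YoungDiagram.rowLen_eq_card, YoungDiagram.row, Finset.filter_filter]
  congr 1
  refine Finset.filter_congr fun c _ => ?_
  rw [Finset.mem_range] at hi
  exact ⟨fun h => h.2, fun h => ⟨h ▸ hi, h⟩⟩

theorem rowSum_eq_sum_min (lam : YoungDiagram) (k : ℕ) :
    rowSum lam k = ∑ j ∈ Finset.range (lam.rowLen 0), min k (lam.colLen j) := by
  rw [rowSum, Finset.card_eq_sum_card_fiberwise (f := Prod.snd)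
    (t := Finset.range (lam.rowLen 0)) (fun c hc => ?_)]
  · refine Finset.sum_congr rfl fun j hj => ?_
    rw [← Finset.card_range (min k _)]
    refine Finset.card_nbij' Prod.fst (fun i => (i, j)) ?_ ?_ ?_ ?_
    · rintro ⟨i, j'⟩ h
      simp only [Finset.coe_filter, Finset.mem_filter, YoungDiagram.mem_cells,
        Set.mem_ofPred_eq] at h
      obtain ⟨⟨h1, h2⟩, rfl⟩ := h
      simpa using ⟨h2, YoungDiagram.mem_iff_lt_colLen.mp h1⟩
    · intro i hi
      simpa [YoungDiagram.mem_iff_lt_colLen, and_comm] using hi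
    · rintro ⟨i, j'⟩ h
      have : j' = j := (Finset.mem_filter.mp h).2
      rw [this]
    · exact fun _ _ => rfl
  · have h1 : c ∈ lam := (Finset.mem_filter.mp hc).1
    have h2 : (0, c.2) ∈ lam := lam.up_left_mem (Nat.zero_le c.1) le_rfl h1
    simpa using YoungDiagram.mem_iff_lt_rowLen.mp h2

theorem rowSum_injective : Function.Injective rowSum := by
  intro mu lam h
  have hr (i : ℕ) : mu.rowLen i = lam.rowLen i := by
    have h1 := congrFun h (i + 1)
    have h2 := congrFun h i
    simp only [rowSum_eq_sum_rowLen, Finset.sum_range_succ] at h1 h2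
    omega
  ext ⟨i, j⟩
  rw [YoungDiagram.mem_cells, YoungDiagram.mem_cells, YoungDiagram.mem_iff_lt_rowLen, hr,
    ← YoungDiagram.mem_iff_lt_rowLen]

theorem rowSum_eq_card {lam : YoungDiagram} {k : ℕ} (h : lam.colLen 0 ≤ k) :
    rowSum lam k = lam.card := by
  rw [rowSum, YoungDiagram.card, Finset.filter_true_of_mem]
  rintro ⟨i, j⟩ hc
  have h2 : (i, 0) ∈ lam := lam.up_left_mem le_rfl (Nat.zero_le j) hc
  exact (YoungDiagram.mem_iff_lt_colLen.mp h2).trans_le h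

theorem degree_rowExp (lam : YoungDiagram) : (rowExp lam).degree = lam.card := by
  rw [← rowSum_eq_card le_rfl, rowSum_eq_sum_rowLen, Finsupp.degree_apply]
  refine Finset.sum_subset Finsupp.support_onFinset_subset fun i _ hi => ?_
  exact Finsupp.notMem_support_iff.mp hi

theorem finite_setOf_card_le (n : ℕ) : {lam : YoungDiagram | lam.card ≤ n}.Finite := by
  refine Set.Finite.of_finite_image (f := YoungDiagram.cells)
    ((Finset.range n ×ˢ Finset.range n).powerset.finite_toSet.subset ?_)
    fun a _ b _ h => YoungDiagram.ext h
  rintro _ ⟨lam, hlam, rfl⟩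
  simp only [Finset.coe_powerset, Set.mem_preimage, Set.mem_powerset_iff, Finset.coe_subset]
  rintro ⟨i, j⟩ hc
  have h1 : lam.rowLen i ≤ lam.card := by
    rw [YoungDiagram.rowLen_eq_card]
    exact Finset.card_le_card (Finset.filter_subset _ _)
  have h2 : lam.colLen j ≤ lam.card := by
    rw [YoungDiagram.colLen_eq_card]
    exact Finset.card_le_card (Finset.filter_subset _ _)
  have h3 := YoungDiagram.mem_iff_lt_rowLen.mp hc
  have h4 := YoungDiagram.mem_iff_lt_colLen.mp hc
  simp only [Set.mem_ofPred_eq] at hlam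
  simp only [Finset.mem_product, Finset.mem_range]
  omega

/-- The coefficients of a symmetric function at the partitions. -/
def partitionCoeffs (K : Type*) [CommRing K] : symmFunc K →ₗ[K] (YoungDiagram →₀ K) where
  toFun f := Finsupp.ofSupportFinite
    (fun mu => MvPowerSeries.coeff (rowExp mu) (f : MvPowerSeries ℕ K)) (by
      obtain ⟨-, N, hN⟩ := f.2
      refine (finite_setOf_card_le N).subset fun mu hmu => ?_
      by_contra h
      refine hmu (hN _ ?_)
      rw [degree_rowExp]
      exact not_le.mp h)
  map_add' f g := by
    ext mu
    simp [Finsupp.ofSupportFinite_coe]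
  map_smul' c f := by
    ext mu
    simp [Finsupp.ofSupportFinite_coe]

theorem partitionCoeffs_apply {K : Type*} [CommRing K] (f : symmFunc K) (mu : YoungDiagram) :
    partitionCoeffs K f mu = MvPowerSeries.coeff (rowExp mu) (f : MvPowerSeries ℕ K) := rfl

theorem coeff_mapDomain_symmFunc {K : Type*} [CommRing K] {f : MvPowerSeries ℕ K}
    (hf : f ∈ symmFunc K) (σ : Equiv.Perm ℕ) (d : ℕ →₀ ℕ) :
    MvPowerSeries.coeff (d.mapDomain σ) f = MvPowerSeries.coeff d f :=
  (rename_eq_self_iff σ f).mp (hf.1 σ) d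

theorem partitionCoeffs_injective (K : Type*) [CommRing K] :
    Function.Injective (partitionCoeffs K) := by
  intro f f' h
  refine Subtype.ext (MvPowerSeries.ext fun d => ?_)
  obtain ⟨σ, mu, rfl⟩ := exists_mapDomain_rowExp d
  rw [coeff_mapDomain_symmFunc f.2, coeff_mapDomain_symmFunc f'.2]
  exact DFunLike.congr_fun h mu

/-! ### Unitriangularity -/

namespace RPP

variable {lam : YoungDiagram}

/-- The entries of a column. -/
def columnSet (T : RPP lam ⊥) (j : ℕ) : Finset ℕ :=
  Finset.univ.image fun i : Fin (lam.colLen j) =>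
    T.entry (cell (YoungDiagram.mem_iff_lt_colLen.mpr i.2))

theorem mem_columnSet (T : RPP lam ⊥) {j n : ℕ} :
    n ∈ T.columnSet j ↔ (j, n) ∈ T.columnEntries := by
  rw [mem_columnEntries]
  simp only [columnSet, Finset.mem_image, Finset.mem_univ, true_and]
  constructor
  · rintro ⟨i, hi⟩
    exact ⟨i, YoungDiagram.mem_iff_lt_colLen.mpr i.2, hi⟩
  · rintro ⟨i, h, hi⟩
    exact ⟨⟨i, YoungDiagram.mem_iff_lt_colLen.mp h⟩, hi⟩

theorem card_columnSet_le (T : RPP lam ⊥) (j : ℕ) : (T.columnSet j).card ≤ lam.colLen j :=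
  Finset.card_image_le.trans (by simp)

theorem card_columnSet_filter_le (T : RPP lam ⊥) (j k : ℕ) :
    ((T.columnSet j).filter (· < k)).card ≤ min k (lam.colLen j) := by
  refine le_min ?_ ((Finset.card_filter_le _ _).trans (T.card_columnSet_le j))
  conv_rhs => rw [← Finset.card_range k]
  exact Finset.card_le_card fun n hn => by simpa using (Finset.mem_filter.mp hn).2

/-- Both sides count the pairs (column, entry) with entry below `k`. -/
theorem sum_weight (T : RPP lam ⊥) (k : ℕ) :
    ∑ i ∈ Finset.range k, T.weight i =
      ∑ j ∈ Finset.range (lam.rowLen 0), ((T.columnSet j).filter (· < k)).card := by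
  trans (T.columnEntries.filter fun p => p.2 < k).card
  · rw [Finset.card_eq_sum_card_fiberwise (f := Prod.snd) (t := Finset.range k)
      (fun c hc => by simpa using (Finset.mem_filter.mp hc).2)]
    refine Finset.sum_congr rfl fun i hi => ?_
    rw [weight_apply, Finset.filter_filter]
    congr 1
    refine Finset.filter_congr fun c _ => ?_
    rw [Finset.mem_range] at hi
    exact ⟨fun h => ⟨h ▸ hi, h⟩, fun h => h.2⟩
  · rw [Finset.card_eq_sum_card_fiberwise (f := Prod.fst)
      (t := Finset.range (lam.rowLen 0)) (fun c hc => ?_)]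
    · refine Finset.sum_congr rfl fun j _ => ?_
      refine Finset.card_nbij' Prod.snd (fun n => (j, n)) ?_ ?_ ?_ ?_
      · rintro ⟨j', n⟩ h
        simp only [Finset.coe_filter, Finset.mem_filter, Set.mem_ofPred_eq] at h
        obtain ⟨⟨h1, h2⟩, rfl⟩ := h
        simpa using ⟨T.mem_columnSet.mpr h1, h2⟩
      · intro n hn
        simpa [mem_columnSet] using hn
      · rintro ⟨j', n⟩ h
        have : j' = j := (Finset.mem_filter.mp h).2
        rw [this]
      · exact fun _ _ => rfl
    · obtain ⟨i, h, -⟩ := T.mem_columnEntries.mp (Finset.mem_filter.mp hc).1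
      have h2 : (0, c.1) ∈ lam := lam.up_left_mem (Nat.zero_le i) le_rfl h
      simpa using YoungDiagram.mem_iff_lt_rowLen.mp h2

/-- Column `j` contains at most `min k (lam.colLen j)` distinct entries below `k`. -/
theorem rowSum_le_of_weight_eq (T : RPP lam ⊥) {mu : YoungDiagram} (h : T.weight = rowExp mu) :
    rowSum mu ≤ rowSum lam := by
  intro k
  have h1 := T.sum_weight k
  rw [h] at h1
  rw [rowSum_eq_sum_rowLen]
  simp only [rowExp_apply] at h1
  rw [h1, rowSum_eq_sum_min]
  exact Finset.sum_le_sum fun j _ => T.card_columnSet_filter_le j k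

theorem entry_eq_of_weight_eq (T : RPP lam ⊥) (h : T.weight = rowExp lam) {i j : ℕ}
    (hc : (i, j) ∈ lam) : T.entry (cell hc) = i := by
  have hj : j ∈ Finset.range (lam.rowLen 0) := by
    have h2 : (0, j) ∈ lam := lam.up_left_mem (Nat.zero_le i) le_rfl hc
    simpa using YoungDiagram.mem_iff_lt_rowLen.mp h2
  -- For this `k` the totals agree, so every column attains its bound. Column `j` then has `colLen
  -- j` distinct entries below `colLen j`, which are therefore `0, 1, …` in order.
  have h1 := T.sum_weight (lam.colLen j)
  rw [h] at h1
  simp only [rowExp_apply] at h1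
  rw [← rowSum_eq_sum_rowLen, rowSum_eq_sum_min] at h1
  have h2 := (Finset.sum_eq_sum_iff_of_le
    fun j' _ => T.card_columnSet_filter_le j' (lam.colLen j)).mp h1.symm j hj
  rw [min_self] at h2
  have h3 : (T.columnSet j).filter (· < lam.colLen j) = T.columnSet j :=
    Finset.eq_of_subset_of_card_le (Finset.filter_subset _ _)
      ((T.card_columnSet_le j).trans h2.ge)
  have h4 : T.columnSet j = Finset.range (lam.colLen j) := by
    refine Finset.eq_of_subset_of_card_le (fun n hn => ?_) ?_
    · rw [← h3] at hn
      simpa using (Finset.mem_filter.mp hn).2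
    · rw [Finset.card_range, ← h2, h3]
  let f : Fin (lam.colLen j) → ℕ := fun i =>
    T.entry (cell (YoungDiagram.mem_iff_lt_colLen.mpr i.2))
  have hinj : Function.Injective f := by
    have hc : (Finset.univ.image f).card = (Finset.univ : Finset (Fin (lam.colLen j))).card := by
      rw [show Finset.univ.image f = T.columnSet j from rfl, h4]
      simp
    simpa using Finset.card_image_iff.mp hc
  have hmono : Monotone f := fun i i' hi => T.col_weak _ _ rfl hi
  have hf : f = Fin.val := ((hmono.strictMono_of_injective hinj).range_inj Fin.val_strictMono).mp (by
    ext n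
    rw [Fin.range_val, ← Finset.coe_range, ← h4]
    simp [f, columnSet])
  exact congrFun hf ⟨i, YoungDiagram.mem_iff_lt_colLen.mp hc⟩

/-- The filling of `lam` whose entries are the row indices. -/
def rowFilling (lam : YoungDiagram) : RPP lam ⊥ where
  entry c := c.1.1
  row_weak _ _ h _ := h.le
  col_weak _ _ _ h := h

theorem weight_rowFilling (lam : YoungDiagram) : (rowFilling lam).weight = rowExp lam := by
  ext n
  rw [weight_apply, rowExp_apply, YoungDiagram.rowLen_eq_card]
  refine Finset.card_nbij' Prod.swap Prod.swap ?_ ?_ (fun _ _ => rfl) (fun _ _ => rfl)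
  · rintro ⟨j, m⟩ h
    simp only [Finset.coe_filter, Set.mem_ofPred_eq, mem_columnEntries] at h
    obtain ⟨⟨i, hi, hm⟩, hn⟩ := h
    obtain rfl : i = m := hm
    exact YoungDiagram.mem_row_iff.mpr ⟨hi, hn⟩
  · rintro ⟨i, j⟩ h
    obtain ⟨h1, rfl⟩ := YoungDiagram.mem_row_iff.mp h
    simp only [Finset.coe_filter, Set.mem_ofPred_eq, mem_columnEntries]
    exact ⟨⟨i, h1, rfl⟩, rfl⟩

end RPP

theorem rppCount_rowExp_self (lam : YoungDiagram) : rppCount lam (rowExp lam) = 1 := by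
  rw [rppCount, Nat.card_eq_one_iff_unique]
  refine ⟨⟨fun T T' => Subtype.ext (RPP.ext_entry fun c => ?_)⟩,
    ⟨⟨RPP.rowFilling lam, RPP.weight_rowFilling lam⟩⟩⟩
  exact (T.1.entry_eq_of_weight_eq T.2 (mem_of_cell c)).trans
    (T'.1.entry_eq_of_weight_eq T'.2 (mem_of_cell c)).symm

theorem rowSum_le_of_rppCount_ne_zero {lam mu : YoungDiagram}
    (h : rppCount lam (rowExp mu) ≠ 0) : rowSum mu ≤ rowSum lam := by
  obtain ⟨⟨T, hT⟩⟩ := (Nat.card_ne_zero.mp h).1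
  exact T.rowSum_le_of_weight_eq hT

theorem finite_setOf_rowSum_lt (lam : YoungDiagram) : {mu | rowSum mu < rowSum lam}.Finite := by
  refine (finite_setOf_card_le lam.card).subset fun mu hmu => ?_
  -- Beyond the last rows of both diagrams, `rowSum` is the number of cells.
  have := (show rowSum mu < rowSum lam from hmu).le (max (mu.colLen 0) (lam.colLen 0))
  rwa [rowSum_eq_card (le_max_left _ _), rowSum_eq_card (le_max_right _ _)] at this

/-- The height of a partition in the dominance order, extended to partitions of all sizes. -/
def dominanceRank (lam : YoungDiagram) : ℕ := {mu | rowSum mu < rowSum lam}.ncard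

theorem dominanceRank_lt {mu lam : YoungDiagram} (h : rowSum mu < rowSum lam) :
    dominanceRank mu < dominanceRank lam :=
  Set.ncard_lt_ncard ⟨fun _ hnu => lt_trans hnu h, fun hs => lt_irrefl (rowSum mu) (hs h)⟩
    (finite_setOf_rowSum_lt lam)

/-- At an index of maximal rank in the support only the diagonal term contributes, whence
injectivity. Surjectivity is by induction on the rank. -/
theorem bijective_linearCombination_of_unitriangular {ι K : Type*} [CommRing K]
    (v : ι → ι →₀ K) (r : ι → ℕ) (h1 : ∀ i, v i i = 1)
    (h2 : ∀ i j, v i j ≠ 0 → j = i ∨ r j < r i) :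
    Function.Bijective (Finsupp.linearCombination K v) := by
  classical
  constructor
  · rw [injective_iff_map_eq_zero]
    intro c hc
    by_contra h0
    obtain ⟨i, hi, hmax⟩ := Finset.exists_max_image c.support r (Finsupp.support_nonempty_iff.mpr h0)
    have h := DFunLike.congr_fun hc i
    rw [Finsupp.linearCombination_apply, Finsupp.sum, Finsupp.finsetSum_apply,
      Finset.sum_eq_single i] at h
    · exact Finsupp.mem_support_iff.mp hi (by simpa [h1] using h)
    · intro j hj hji
      have : v j i = 0 := by
        by_contra hv
        rcases h2 j i hv with h | h
        · exact hji h.symm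
        · exact (hmax j hj).not_gt h
      simp [this]
    · exact fun h => absurd hi h
  · rw [← LinearMap.range_eq_top, eq_top_iff, ← Finsupp.span_single_eq_top]
    have key : ∀ n i, r i = n →
        Finsupp.single i 1 ∈ LinearMap.range (Finsupp.linearCombination K v) := by
      intro n
      induction n using Nat.strong_induction_on with
      | _ n ih =>
        intro i hi
        have he : Finsupp.single i 1 = v i - (v i).erase i := by
          rw [eq_sub_iff_add_eq, ← h1 i, Finsupp.single_add_erase]
        rw [he]
        refine Submodule.sub_mem _ ⟨Finsupp.single i 1, by simp⟩ ?_
        rw [← Finsupp.sum_single ((v i).erase i)]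
        refine Submodule.sum_mem _ fun j hj => ?_
        rw [Finsupp.support_erase, Finset.mem_erase, Finsupp.mem_support_iff] at hj
        rcases h2 i j hj.2 with h | h
        · exact absurd h hj.1
        · rw [← Finsupp.smul_single_one]
          exact Submodule.smul_mem _ _ (ih _ (hi ▸ h) j rfl)
    refine Submodule.span_le.mpr ?_
    rintro _ ⟨i, x, rfl⟩
    rw [← Finsupp.smul_single_one]
    exact Submodule.smul_mem _ _ (key _ i rfl)

/-! ### The basis of the `g_lam` and the coordinates at partitions -/

/-- `g_lam` as an element of `Λ`. -/
def gSymm (K : Type*) [CommRing K] (lam : YoungDiagram) : symmFunc K :=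
  ⟨g K lam, g_mem_symmFunc K lam⟩

theorem bijective_linearCombination_partitionCoeffs (K : Type*) [CommRing K] :
    Function.Bijective (Finsupp.linearCombination K (partitionCoeffs K ∘ gSymm K)) := by
  refine bijective_linearCombination_of_unitriangular _ dominanceRank (fun lam => ?_)
    fun lam mu h => ?_
  · simp [partitionCoeffs_apply, gSymm, coeff_g, rppCount_rowExp_self]
  · have h' : rppCount lam (rowExp mu) ≠ 0 := by
      rintro h0
      simp [partitionCoeffs_apply, gSymm, coeff_g, h0] at h
    rcases (rowSum_le_of_rppCount_ne_zero h').eq_or_lt with h1 | h1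
    · exact Or.inl (rowSum_injective h1)
    · exact Or.inr (dominanceRank_lt h1)

theorem partitionCoeffs_comp_linearCombination (K : Type*) [CommRing K] :
    (partitionCoeffs K : symmFunc K → YoungDiagram →₀ K) ∘
      Finsupp.linearCombination K (gSymm K) =
    Finsupp.linearCombination K (partitionCoeffs K ∘ gSymm K) :=
  funext fun l => Finsupp.apply_linearCombination K (partitionCoeffs K) (gSymm K) l

/-- Symmetric functions correspond to their coefficients at the partitions. -/
def partitionCoeffsEquiv (K : Type*) [CommRing K] : symmFunc K ≃ₗ[K] (YoungDiagram →₀ K) :=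
  LinearEquiv.ofBijective (partitionCoeffs K) ⟨partitionCoeffs_injective K, by
    have h := (bijective_linearCombination_partitionCoeffs K).2
    rw [← partitionCoeffs_comp_linearCombination] at h
    exact h.of_comp⟩

/-- The composite with `partitionCoeffs` is bijective and `partitionCoeffs` is injective, so both
factors are bijective. -/
theorem bijective_linearCombination_gSymm (K : Type*) [CommRing K] :
    Function.Bijective (Finsupp.linearCombination K (gSymm K)) := by
  have h := bijective_linearCombination_partitionCoeffs K
  rw [← partitionCoeffs_comp_linearCombination] at h
  exact ⟨h.1.of_comp, (Function.Surjective.of_comp_iff' (partitionCoeffsEquiv K).bijective _).mp h.2⟩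

/-- The basis of `Λ` that consists of the `g_lam`. -/
def gBasis (K : Type*) [CommRing K] : Module.Basis YoungDiagram K (symmFunc K) :=
  Module.Basis.ofRepr
    (LinearEquiv.ofBijective _ (bijective_linearCombination_gSymm K)).symm

theorem gBasis_apply (K : Type*) [CommRing K] (lam : YoungDiagram) :
    gBasis K lam = gSymm K lam := by
  simp [gBasis, Module.Basis.coe_ofRepr]

/-! ### Series in two sets of variables -/

/-- The exponent with components `d` and `e`. -/
def pairExp (d e : ℕ →₀ ℕ) : ℕ ⊕ ℕ →₀ ℕ :=
  d.embDomain Function.Embedding.inl + e.embDomain Function.Embedding.inr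

theorem pairExp_eq_mapDomain (d e : ℕ →₀ ℕ) :
    pairExp d e = d.mapDomain Sum.inl + e.mapDomain Sum.inr := by
  rw [pairExp, Finsupp.embDomain_eq_mapDomain, Finsupp.embDomain_eq_mapDomain]
  rfl

theorem pairExp_inl (d e : ℕ →₀ ℕ) (n : ℕ) : pairExp d e (Sum.inl n) = d n := by
  rw [pairExp_eq_mapDomain, Finsupp.add_apply, Finsupp.mapDomain_apply Sum.inl_injective,
    Finsupp.mapDomain_of_notMem_range _ _ (by simp), add_zero]

theorem pairExp_inr (d e : ℕ →₀ ℕ) (n : ℕ) : pairExp d e (Sum.inr n) = e n := by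
  rw [pairExp_eq_mapDomain, Finsupp.add_apply, Finsupp.mapDomain_apply Sum.inr_injective,
    Finsupp.mapDomain_of_notMem_range _ _ (by simp), zero_add]

theorem pairExp_inj {d e d' e' : ℕ →₀ ℕ} (h : pairExp d e = pairExp d' e') : d = d' ∧ e = e' :=
  ⟨Finsupp.ext fun n => by rw [← pairExp_inl d e, h, pairExp_inl],
    Finsupp.ext fun n => by rw [← pairExp_inr d e, h, pairExp_inr]⟩

theorem exists_eq_pairExp (x : ℕ ⊕ ℕ →₀ ℕ) : ∃ d e, x = pairExp d e := by
  refine ⟨x.comapDomain Sum.inl Sum.inl_injective.injOn,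
    x.comapDomain Sum.inr Sum.inr_injective.injOn, Finsupp.ext ?_⟩
  rintro (n | n)
  · rw [pairExp_inl, Finsupp.comapDomain_apply]
  · rw [pairExp_inr, Finsupp.comapDomain_apply]

theorem pairExp_mapDomain (d e : ℕ →₀ ℕ) (σ τ : Equiv.Perm ℕ) :
    pairExp (d.mapDomain σ) (e.mapDomain τ) = (pairExp d e).mapDomain (Equiv.sumCongr σ τ) := by
  simp only [pairExp_eq_mapDomain, Finsupp.mapDomain_add, ← Finsupp.mapDomain_comp]
  rfl

/-- Only the splitting of the exponent into its two components contributes to the product. -/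
theorem coeff_pairExp_mul {K : Type*} [CommRing K] (u v : MvPowerSeries ℕ K) (d e : ℕ →₀ ℕ) :
    MvPowerSeries.coeff (pairExp d e)
      (MvPowerSeries.rename (Function.Embedding.inl : ℕ ↪ ℕ ⊕ ℕ) u *
        MvPowerSeries.rename (Function.Embedding.inr : ℕ ↪ ℕ ⊕ ℕ) v) =
      MvPowerSeries.coeff d u * MvPowerSeries.coeff e v := by
  classical
  rw [MvPowerSeries.coeff_mul, Finset.sum_eq_single (d.embDomain Function.Embedding.inl,
    e.embDomain Function.Embedding.inr)]
  · rw [MvPowerSeries.coeff_embDomain_rename, MvPowerSeries.coeff_embDomain_rename]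
  · rintro ⟨p, q⟩ hpq hne
    rw [Finset.HasAntidiagonal.mem_antidiagonal] at hpq
    by_cases hp : p ∈ Set.range (Finsupp.mapDomain (Function.Embedding.inl : ℕ ↪ ℕ ⊕ ℕ))
    · by_cases hq : q ∈ Set.range (Finsupp.mapDomain (Function.Embedding.inr : ℕ ↪ ℕ ⊕ ℕ))
      · obtain ⟨d', rfl⟩ := hp
        obtain ⟨e', rfl⟩ := hq
        rw [← Finsupp.embDomain_eq_mapDomain, ← Finsupp.embDomain_eq_mapDomain] at hpq hne
        obtain ⟨rfl, rfl⟩ := pairExp_inj hpq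
        exact absurd rfl hne
      · rw [MvPowerSeries.coeff_rename_eq_zero _ _ hq, mul_zero]
    · rw [MvPowerSeries.coeff_rename_eq_zero _ _ hp, zero_mul]
  · intro h
    refine absurd (Finset.HasAntidiagonal.mem_antidiagonal.mpr ?_) h
    rw [pairExp]

theorem coeff_tensorToSeries_tmul {K : Type*} [CommRing K] (u v : symmFunc K) (d e : ℕ →₀ ℕ) :
    MvPowerSeries.coeff (pairExp d e) (tensorToSeries K (u ⊗ₜ v)) =
      MvPowerSeries.coeff d (u : MvPowerSeries ℕ K) *
        MvPowerSeries.coeff e (v : MvPowerSeries ℕ K) := by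
  rw [tensorToSeries, Algebra.TensorProduct.productMap_apply_tmul]
  exact coeff_pairExp_mul _ _ d e

/-! ### The coproduct -/

/-- Elements of `Λ ⊗ Λ` correspond to their coefficients at the pairs of partitions. -/
def tensorCoeffs (K : Type*) [CommRing K] :
    symmFunc K ⊗[K] symmFunc K ≃ₗ[K] (YoungDiagram × YoungDiagram →₀ K) :=
  (TensorProduct.congr (partitionCoeffsEquiv K) (partitionCoeffsEquiv K)).trans
    (finsuppTensorFinsupp' K YoungDiagram YoungDiagram)

theorem tensorCoeffs_apply {K : Type*} [CommRing K] (z : symmFunc K ⊗[K] symmFunc K)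
    (p : YoungDiagram × YoungDiagram) :
    tensorCoeffs K z p =
      MvPowerSeries.coeff (pairExp (rowExp p.1) (rowExp p.2)) (tensorToSeries K z) := by
  induction z with
  | zero => simp
  | add z z' hz hz' => rw [map_add, map_add, map_add, Finsupp.add_apply, hz, hz']
  | tmul u v =>
    rw [coeff_tensorToSeries_tmul, tensorCoeffs, LinearEquiv.trans_apply,
      TensorProduct.congr_tmul, finsuppTensorFinsupp'_apply_apply]
    rfl

theorem tensorToSeries_injective (K : Type*) [CommRing K] :
    Function.Injective (tensorToSeries K) := by
  intro z z' h
  refine (tensorCoeffs K).injective (Finsupp.ext fun p => ?_)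
  rw [tensorCoeffs_apply, tensorCoeffs_apply, h]

theorem coeff_mapDomain_tensorToSeries {K : Type*} [CommRing K] (z : symmFunc K ⊗[K] symmFunc K)
    (d e : ℕ →₀ ℕ) (σ τ : Equiv.Perm ℕ) :
    MvPowerSeries.coeff (pairExp (d.mapDomain σ) (e.mapDomain τ)) (tensorToSeries K z) =
      MvPowerSeries.coeff (pairExp d e) (tensorToSeries K z) := by
  induction z with
  | zero => simp
  | add z z' hz hz' => rw [map_add, map_add, map_add, hz, hz']
  | tmul u v =>
    rw [coeff_tensorToSeries_tmul, coeff_tensorToSeries_tmul, coeff_mapDomain_symmFunc u.2,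
      coeff_mapDomain_symmFunc v.2]

theorem coeff_doubleVars {K : Type*} [CommRing K] (f : MvPowerSeries ℕ K) (x : ℕ ⊕ ℕ →₀ ℕ) :
    MvPowerSeries.coeff x (doubleVars f) =
      MvPowerSeries.coeff (x.mapDomain Equiv.natSumNatEquivNat) f := by
  rw [← coeff_mapDomain_rename Equiv.natSumNatEquivNat.symm f, ← Finsupp.mapDomain_comp,
    Equiv.symm_comp_self, Finsupp.mapDomain_id]
  rfl

theorem coeff_mapDomain_doubleVars {K : Type*} [CommRing K] {f : MvPowerSeries ℕ K}
    (hf : f ∈ symmFunc K) (ρ : Equiv.Perm (ℕ ⊕ ℕ)) (x : ℕ ⊕ ℕ →₀ ℕ) :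
    MvPowerSeries.coeff (x.mapDomain ρ) (doubleVars f) = MvPowerSeries.coeff x (doubleVars f) := by
  have h := coeff_mapDomain_symmFunc hf
    ((Equiv.natSumNatEquivNat.symm.trans ρ).trans Equiv.natSumNatEquivNat)
    (x.mapDomain Equiv.natSumNatEquivNat)
  rw [coeff_doubleVars, coeff_doubleVars, ← h, ← Finsupp.mapDomain_comp, ← Finsupp.mapDomain_comp]
  congr 2
  refine congrArg (fun φ => Finsupp.mapDomain φ x) (funext fun a => ?_)
  exact congrArg (fun b => Equiv.natSumNatEquivNat (ρ b))
    (Equiv.symm_apply_apply Equiv.natSumNatEquivNat a).symm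

/-- The series `f(x, y)` is invariant under separate permutations of `x` and `y`, so its
coefficients at pairs of partitions determine it. Bounded degree leaves finitely many of them, and
`tensorCoeffs` realizes any such family. -/
theorem exists_tensorToSeries_eq {K : Type*} [CommRing K] (f : symmFunc K) :
    ∃ z, tensorToSeries K z = doubleVars (f : MvPowerSeries ℕ K) := by
  have hfin : (Function.support fun p : YoungDiagram × YoungDiagram =>
      MvPowerSeries.coeff (pairExp (rowExp p.1) (rowExp p.2))
        (doubleVars (f : MvPowerSeries ℕ K))).Finite := by
    obtain ⟨-, N, hN⟩ := f.2
    refine ((finite_setOf_card_le N).prod (finite_setOf_card_le N)).subset fun p hp => ?_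
    have h : ¬ N < p.1.card + p.2.card := by
      intro h
      refine hp ?_
      simp only [coeff_doubleVars]
      refine hN _ ?_
      rwa [Finsupp.degree_mapDomain, pairExp_eq_mapDomain, map_add, Finsupp.degree_mapDomain,
        Finsupp.degree_mapDomain, degree_rowExp, degree_rowExp]
    constructor
    · simp only [Set.mem_ofPred_eq]
      omega
    · simp only [Set.mem_ofPred_eq]
      omega
  refine ⟨(tensorCoeffs K).symm (Finsupp.ofSupportFinite _ hfin), MvPowerSeries.ext fun x => ?_⟩
  obtain ⟨d, e, rfl⟩ := exists_eq_pairExp x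
  obtain ⟨σ, mu, rfl⟩ := exists_mapDomain_rowExp d
  obtain ⟨τ, nu, rfl⟩ := exists_mapDomain_rowExp e
  rw [coeff_mapDomain_tensorToSeries, pairExp_mapDomain, coeff_mapDomain_doubleVars f.2,
    ← tensorCoeffs_apply _ (mu, nu), LinearEquiv.apply_symm_apply, Finsupp.ofSupportFinite_coe]

/-- The coproduct of `Λ`. -/
def coproduct (K : Type*) [CommRing K] : symmFunc K →ₗ[K] symmFunc K ⊗[K] symmFunc K :=
  (gBasis K).constr K fun lam => (exists_tensorToSeries_eq (gSymm K lam)).choose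

theorem isCoproduct_coproduct (K : Type*) [CommRing K] : IsCoproduct (coproduct K) := by
  have h : (tensorToSeries K).toLinearMap ∘ₗ coproduct K =
      (MvPowerSeries.rename Equiv.natSumNatEquivNat.symm).toLinearMap ∘ₗ
        (symmFunc K).val.toLinearMap := by
    refine (gBasis K).ext fun lam => ?_
    rw [LinearMap.comp_apply, coproduct, Module.Basis.constr_basis, gBasis_apply]
    exact (exists_tensorToSeries_eq (gSymm K lam)).choose_spec
  exact fun f => LinearMap.congr_fun h f

theorem isCoproduct_iff {K : Type*} [CommRing K]
    (Δ : symmFunc K →ₗ[K] symmFunc K ⊗[K] symmFunc K) : IsCoproduct Δ ↔ Δ = coproduct K := by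
  constructor
  · intro h
    ext1 f
    exact tensorToSeries_injective K ((h f).trans (isCoproduct_coproduct K f).symm)
  · rintro rfl
    exact isCoproduct_coproduct K

/-! ### Specialization of the first variable to one -/

/-- The exponent `(k, e 0, e 1, …)`. -/
def consExp (k : ℕ) (e : ℕ →₀ ℕ) : ℕ →₀ ℕ :=
  Finsupp.single 0 k + e.mapDomain Nat.succ

theorem consExp_zero (k : ℕ) (e : ℕ →₀ ℕ) : consExp k e 0 = k := by
  rw [consExp, Finsupp.add_apply, Finsupp.single_eq_same,
    Finsupp.mapDomain_of_notMem_range _ _ (by simp), add_zero]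

theorem exists_eq_consExp (d : ℕ →₀ ℕ) : ∃ k e, d = consExp k e := by
  refine ⟨d 0, d.comapDomain Nat.succ Nat.succ_injective.injOn, Finsupp.ext fun n => ?_⟩
  cases n with
  | zero => rw [consExp_zero]
  | succ n =>
    rw [consExp, Finsupp.add_apply, Finsupp.single_eq_of_ne (by simp), zero_add,
      show n + 1 = Nat.succ n from rfl, Finsupp.mapDomain_apply Nat.succ_injective,
      Finsupp.comapDomain_apply]

theorem consExp_injective (e : ℕ →₀ ℕ) : Function.Injective fun k => consExp k e := by
  intro k k' h
  have := DFunLike.congr_fun h 0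
  simpa only [consExp_zero] using this

theorem le_degree_consExp (k : ℕ) (e : ℕ →₀ ℕ) : k ≤ (consExp k e).degree := by
  simp [consExp, map_add]

theorem prod_consExp {R : Type*} [CommMonoid R] (a : ℕ → R) (k : ℕ) (e : ℕ →₀ ℕ) :
    ((consExp k e).prod fun n m => a n ^ m) = a 0 ^ k * e.prod fun n m => a (n + 1) ^ m := by
  rw [consExp, Finsupp.prod_add_index' (by simp) (fun n m m' => pow_add _ _ _),
    Finsupp.prod_single_index (by simp),
    Finsupp.prod_mapDomain_index (by simp) (fun n m m' => pow_add _ _ _)]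

/-- The substitution forgets the exponent of the variable `0`, so exactly the monomials `(k, e)`
contribute at `e`. -/
theorem coeff_substSeq_oneVars {K : Type*} [CommRing K] {f : MvPowerSeries ℕ K} {N : ℕ}
    (hN : ∀ d : ℕ →₀ ℕ, N < d.degree → MvPowerSeries.coeff d f = 0) {M : ℕ} (hM : N < M)
    (e : ℕ →₀ ℕ) :
    MvPowerSeries.coeff e (substSeq (oneVars K) f) =
      ∑ k ∈ Finset.range M, MvPowerSeries.coeff (consExp k e) f := by
  classical
  have hmon (k : ℕ) (e' : ℕ →₀ ℕ) : MvPowerSeries.coeff e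
      ((consExp k e').prod fun n k => oneVars K n ^ k) = if e = e' then 1 else 0 := by
    rw [prod_consExp, ← MvPowerSeries.coeff_monomial, MvPowerSeries.monomial_one_eq]
    simp [oneVars]
  have hsub : MvPowerSeries.coeff e (substSeq (oneVars K) f) = ∑ᶠ d : ℕ →₀ ℕ,
    MvPowerSeries.coeff d f * MvPowerSeries.coeff e (d.prod fun n k => oneVars K n ^ k) := rfl
  rw [hsub, finsum_eq_sum_of_support_subset (s := (Finset.range M).image fun k => consExp k e),
    Finset.sum_image (consExp_injective e).injOn]
  · exact Finset.sum_congr rfl fun k _ => by rw [hmon, if_pos rfl, mul_one]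
  · intro d hd
    obtain ⟨k, e', rfl⟩ := exists_eq_consExp d
    rw [Function.mem_support, hmon] at hd
    have he : e = e' := by
      by_contra h
      simp [h] at hd
    subst he
    have hk : ¬ N < (consExp k e).degree := fun h => hd (by rw [hN _ h, zero_mul])
    have := le_degree_consExp k e
    simp only [Finset.coe_image, Finset.coe_range, Set.mem_image, Set.mem_Iio]
    exact ⟨k, by omega, rfl⟩

theorem evalOne_eq_sum {K : Type*} [CommRing K] (f : symmFunc K) {N : ℕ}
    (hN : ∀ d : ℕ →₀ ℕ, N < d.degree → MvPowerSeries.coeff d (f : MvPowerSeries ℕ K) = 0)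
    {M : ℕ} (hM : N < M) :
    evalOne K f =
      ∑ k ∈ Finset.range M, MvPowerSeries.coeff (Finsupp.single 0 k) (f : MvPowerSeries ℕ K) := by
  classical
  -- As `0 ^ 0 = 1`, precisely the exponents with `e = 0` survive.
  have hmon (k : ℕ) (e : ℕ →₀ ℕ) :
      ((consExp k e).prod fun n k => oneZeros K n ^ k) = 0 ^ e.degree := by
    rw [prod_consExp, Finsupp.degree_apply, ← Finset.prod_pow_eq_pow_sum]
    simp [oneZeros, Finsupp.prod]
  have hcons (k : ℕ) : consExp k 0 = Finsupp.single 0 k := by simp [consExp]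
  have hev : evalOne K f = ∑ᶠ d : ℕ →₀ ℕ, MvPowerSeries.coeff d (f : MvPowerSeries ℕ K) *
    d.prod fun n k => oneZeros K n ^ k := rfl
  rw [hev, finsum_eq_sum_of_support_subset (s := (Finset.range M).image fun k => consExp k 0),
    Finset.sum_image (consExp_injective 0).injOn]
  · exact Finset.sum_congr rfl fun k _ => by rw [hmon, hcons]; simp
  · intro d hd
    obtain ⟨k, e, rfl⟩ := exists_eq_consExp d
    rw [Function.mem_support, hmon] at hd
    have he : e = 0 := by
      by_contra h
      rw [zero_pow (by simpa [Finsupp.degree_eq_zero_iff] using h), mul_zero] at hd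
      exact hd rfl
    subst he
    have hk : ¬ N < (consExp k 0).degree := fun h => hd (by rw [hN _ h, zero_mul])
    have := le_degree_consExp k 0
    simp only [Finset.coe_image, Finset.coe_range, Set.mem_image, Set.mem_Iio]
    exact ⟨k, by omega, rfl⟩

/-- The cutoff depends on the tensor but not on `e`, and any larger one also works; this lets two
tensors be added. -/
theorem exists_coeff_lid_rTensor_evalOne {K : Type*} [CommRing K]
    (z : symmFunc K ⊗[K] symmFunc K) :
    ∃ M₀, ∀ M, M₀ ≤ M → ∀ e, MvPowerSeries.coeff e
      ((TensorProduct.lid K (symmFunc K) ((evalOne K).rTensor (symmFunc K) z) : symmFunc K) :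
        MvPowerSeries ℕ K) =
      ∑ k ∈ Finset.range M,
        MvPowerSeries.coeff (pairExp (Finsupp.single 0 k) e) (tensorToSeries K z) := by
  induction z with
  | zero => exact ⟨0, by simp⟩
  | add z z' hz hz' =>
    obtain ⟨M₁, h₁⟩ := hz
    obtain ⟨M₂, h₂⟩ := hz'
    refine ⟨max M₁ M₂, fun M hM e => ?_⟩
    rw [map_add, map_add, Subalgebra.coe_add, map_add, h₁ M ((le_max_left _ _).trans hM),
      h₂ M ((le_max_right _ _).trans hM), ← Finset.sum_add_distrib]
    simp only [map_add]
  | tmul u v =>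
    obtain ⟨-, N, hN⟩ := u.2
    refine ⟨N + 1, fun M hM e => ?_⟩
    rw [LinearMap.rTensor_tmul, TensorProduct.lid_tmul, evalOne_eq_sum u hN hM]
    simp only [coeff_tensorToSeries_tmul]
    rw [← Finset.sum_mul]
    simp

/-- The coefficients of a symmetric function are invariant under all injections of the variables. -/
theorem coeff_mapDomain_of_injective {K : Type*} [CommRing K] (f : symmFunc K) {φ : ℕ → ℕ}
    (hφ : Function.Injective φ) (d : ℕ →₀ ℕ) :
    MvPowerSeries.coeff (d.mapDomain φ) (f : MvPowerSeries ℕ K) =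
      MvPowerSeries.coeff d (f : MvPowerSeries ℕ K) := by
  have h : MvPowerSeries.coeff (d.mapDomain φ) ∘ₗ (symmFunc K).val.toLinearMap =
      MvPowerSeries.coeff d ∘ₗ (symmFunc K).val.toLinearMap := by
    refine (gBasis K).ext fun lam => ?_
    rw [gBasis_apply]
    change MvPowerSeries.coeff _ (g K lam) = MvPowerSeries.coeff _ (g K lam)
    rw [coeff_g, coeff_g, rppCount_mapDomain _ _ hφ]
  exact LinearMap.congr_fun h f

theorem coeff_coproduct {K : Type*} [CommRing K] (f : symmFunc K) (k : ℕ) (e : ℕ →₀ ℕ) :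
    MvPowerSeries.coeff (pairExp (Finsupp.single 0 k) e) (tensorToSeries K (coproduct K f)) =
      MvPowerSeries.coeff (consExp k e) (f : MvPowerSeries ℕ K) := by
  -- The first variable goes to `x₁` and the others to `y₁, y₂, …`. This misses `x₂, x₃, …`, so
  -- invariance under injections is required.
  let ψ : ℕ → ℕ ⊕ ℕ := fun n => Nat.casesOn n (Sum.inl 0) Sum.inr
  have hψ : Function.Injective ψ := by
    rintro (_ | m) (_ | n) h
    · rfl
    · exact absurd h Sum.inl_ne_inr
    · exact absurd h Sum.inr_ne_inl
    · exact congrArg Nat.succ (Sum.inr_injective h)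
  have h : pairExp (Finsupp.single 0 k) e = (consExp k e).mapDomain ψ := by
    rw [pairExp_eq_mapDomain, consExp, Finsupp.mapDomain_add, ← Finsupp.mapDomain_comp,
      Finsupp.mapDomain_single, Finsupp.mapDomain_single]
    rfl
  rw [isCoproduct_coproduct, coeff_doubleVars, h, ← Finsupp.mapDomain_comp,
    coeff_mapDomain_of_injective f (Equiv.natSumNatEquivNat.injective.comp hψ)]

theorem rppCount_consExp (lam : YoungDiagram) (k : ℕ) (e : ℕ →₀ ℕ) :
    rppCount lam (consExp k e) = layerSum k (fun mu => rppCount mu e) lam := by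
  obtain ⟨N, hN⟩ : ∃ N, ∀ n ∈ e.support, n < N := by
    refine ⟨e.support.sup id + 1, fun n hn => ?_⟩
    have := Finset.le_sup (f := id) hn
    simp only [id] at this
    omega
  -- `φ` is the cycle on `0, …, N` that makes the variable `0` the largest and undoes the shift on
  -- the support of `e`.
  let φ : ℕ → ℕ := fun m => if m = 0 then N else if m ≤ N then m - 1 else m
  have hφ : Function.Injective φ := by
    intro m n h
    simp only [φ] at h
    split_ifs at h <;> omega
  have h : (consExp k e).mapDomain φ = Finsupp.single N k + e := by
    rw [consExp, Finsupp.mapDomain_add, Finsupp.mapDomain_single, ← Finsupp.mapDomain_comp]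
    congr 1
    conv_rhs => rw [← Finsupp.mapDomain_id (v := e)]
    refine Finsupp.mapDomain_congr fun n hn => ?_
    have := hN n hn
    change (if n + 1 = 0 then N else if n + 1 ≤ N then n + 1 - 1 else n + 1) = n
    rw [if_neg (by omega), if_pos (by omega), Nat.add_sub_cancel]
  rw [← rppCount_mapDomain lam _ hφ, h, rppCount_single_add lam k hN]

/-- Every `mu ⊂ lam` has exactly one column count `k`, and it is at most `lam.card`. -/
theorem sum_rppCount_consExp (lam : YoungDiagram) (e : ℕ →₀ ℕ) {M : ℕ} (hM : lam.card < M) :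
    ∑ k ∈ Finset.range M, rppCount lam (consExp k e) =
      ∑ mu ∈ subdiagrams lam, rppCount mu e := by
  classical
  simp only [rppCount_consExp, layerSum]
  refine Finset.sum_fiberwise_of_maps_to (fun mu _ => ?_) _
  rw [Finset.mem_range]
  exact (Finset.card_image_le.trans (Finset.card_le_card Finset.sdiff_subset)).trans_lt hM

/-- By linearity it suffices to treat the `g_lam`. The right-hand side is the common form of the
coefficients of `f(1, x)` and `(i ⊗ id)(Δ f)`. -/
theorem exists_coeff_sumMap {K : Type*} [CommRing K] (f : symmFunc K) :
    ∃ M₀, ∀ M, M₀ ≤ M → ∀ e, MvPowerSeries.coeff e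
      (sumMap (gBasis K) f : MvPowerSeries ℕ K) =
      ∑ k ∈ Finset.range M, MvPowerSeries.coeff (consExp k e) (f : MvPowerSeries ℕ K) := by
  have hf : f ∈ Submodule.span K (Set.range (gBasis K)) := by
    rw [Module.Basis.span_eq]
    exact Submodule.mem_top
  induction hf using Submodule.span_induction with
  | mem x hx =>
    obtain ⟨lam, rfl⟩ := hx
    refine ⟨lam.card + 1, fun M hM e => ?_⟩
    rw [sumMap, Module.Basis.constr_basis]
    simp only [gBasis_apply, gSymm, coeff_g, AddSubmonoidClass.coe_finsetSum, map_sum]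
    exact_mod_cast congrArg (Nat.cast (R := K)) (sum_rppCount_consExp lam e hM).symm
  | zero => exact ⟨0, by simp⟩
  | add x y _ _ hx hy =>
    obtain ⟨M₁, h₁⟩ := hx
    obtain ⟨M₂, h₂⟩ := hy
    refine ⟨max M₁ M₂, fun M hM e => ?_⟩
    rw [map_add, Subalgebra.coe_add, map_add, h₁ M ((le_max_left _ _).trans hM),
      h₂ M ((le_max_right _ _).trans hM), ← Finset.sum_add_distrib]
    simp only [Subalgebra.coe_add, map_add]
  | smul c x _ hx =>
    obtain ⟨M₁, h₁⟩ := hx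
    refine ⟨M₁, fun M hM e => ?_⟩
    rw [map_smul, Subalgebra.coe_smul, map_smul, h₁ M hM, Finset.smul_sum]
    simp only [Subalgebra.coe_smul, map_smul]

theorem sumMap_eq_substSeq {K : Type*} [CommRing K] (f : symmFunc K) :
    (sumMap (gBasis K) f : MvPowerSeries ℕ K) =
      substSeq (oneVars K) (f : MvPowerSeries ℕ K) := by
  ext e
  obtain ⟨M₀, h⟩ := exists_coeff_sumMap f
  obtain ⟨-, N, hN⟩ := f.2
  rw [h (max M₀ (N + 1)) (le_max_left _ _) e,
    coeff_substSeq_oneVars hN (M := max M₀ (N + 1))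
    (Nat.lt_of_succ_le (le_max_right _ _))]

theorem sumMap_eq_comp_coproduct (K : Type*) [CommRing K] :
    sumMap (gBasis K) = (TensorProduct.lid K (symmFunc K)).toLinearMap ∘ₗ
      LinearMap.rTensor (symmFunc K) (evalOne K) ∘ₗ coproduct K := by
  refine LinearMap.ext fun f => Subtype.ext (MvPowerSeries.ext fun e => ?_)
  obtain ⟨M₁, h₁⟩ := exists_coeff_sumMap f
  obtain ⟨M₂, h₂⟩ := exists_coeff_lid_rTensor_evalOne (coproduct K f)
  rw [h₁ (max M₁ M₂) (le_max_left _ _)]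
  refine Eq.trans ?_ (h₂ (max M₁ M₂) (le_max_right _ _) e).symm
  simp only [coeff_coproduct]

end

end DualGrothendieck

/-- The `g_lam` form a basis `b` of `Λ`, the coproduct `Δ` of `Λ` exists and is unique, and the
linear map `I` with `I(g_lam) = ∑ mu ⊂ lam, g_mu` satisfies `I(f) = f(1, x₁, x₂, …)` for all
`f ∈ Λ` and `I = (i ⊗ id) ∘ Δ`. -/
theorem mainTheorem3 (K : Type*) [CommRing K] :
    ∃ b : Module.Basis YoungDiagram K (DualGrothendieck.symmFunc K),
      (∀ lam : YoungDiagram, (b lam : MvPowerSeries ℕ K) = DualGrothendieck.g K lam) ∧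
      (∀ f : DualGrothendieck.symmFunc K,
        (DualGrothendieck.sumMap b f : MvPowerSeries ℕ K) =
          DualGrothendieck.substSeq (DualGrothendieck.oneVars K) (f : MvPowerSeries ℕ K)) ∧
      ∃ Δ : DualGrothendieck.symmFunc K →ₗ[K]
          DualGrothendieck.symmFunc K ⊗[K] DualGrothendieck.symmFunc K,
        (∀ Δ', DualGrothendieck.IsCoproduct Δ' ↔ Δ' = Δ) ∧
        DualGrothendieck.sumMap b =
          (TensorProduct.lid K (DualGrothendieck.symmFunc K)).toLinearMap ∘ₗ
            LinearMap.rTensor (DualGrothendieck.symmFunc K) (DualGrothendieck.evalOne K) ∘ₗ Δ := by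
  refine ⟨DualGrothendieck.gBasis K, fun lam => ?_, DualGrothendieck.sumMap_eq_substSeq,
    DualGrothendieck.coproduct K, DualGrothendieck.isCoproduct_iff,
    DualGrothendieck.sumMap_eq_comp_coproduct K⟩
  rw [DualGrothendieck.gBasis_apply]
  rfl
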